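/- For a nonnegative Borel measure $\mu$ on $[0,\infty)$ and $\rho\in\mathbb R$ put $$\|\mu\|_\rho=\sup_{R>1}\frac{1}{(1+R)^{\rho}}\,\frac1R\,\mu([R/2,R])+\mu([0,1]),$$ and let $\mathcal M^\rho_+$ be the set of $\mu$ with $\|\mu\|_\rho<\infty$. For $\alpha\ge 0$ and $\varepsilon>0$ put $$N_\alpha(\mu,\varepsilon)=\varepsilon^{-\alpha}\int_{[0,\varepsilon]}\Big(1-\frac x\varepsilon\Big)^2d\mu(x),\qquad \underline N_\alpha(\mu)=\lim_{\varepsilon\to0^+}\ \inf_{0<\delta\le\varepsilon}N_\alpha(\mu,\delta),\qquad \overline N_\alpha(\mu)=\lim_{\varepsilon\to0^+}\ \sup_{0<\delta\le\varepsilon}N_\alpha(\mu,\delta),$$ with values in $[0,\infty]$. Let $\rho<-1$ and $g_0\in\mathcal M^\rho_+$. A family $(g(t))_{t\ge0}$ of measures in $\mathcal M^\rho_+$ with $g(0)=g_0$ is called a (nonnegative) weak solution of the radial Schrödinger wave kinetic equation (written for $g=\sqrt\omega f$) with initial datum $g_0$ if $t\mapsto g(t)$ is weakly continuous on $[0,\infty)$,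 that is, $t\mapsto\int\psi\,dg(t)$ is continuous for every $\psi\in C_c([0,\infty))$, and if for every compactly supported $\varphi\in C^2([0,\infty)\times[0,\infty))$ and every $T>0$ $$\int\varphi(T,\omega)\,dg(T)(\omega)-\int\varphi(0,\omega)\,dg_0(\omega)=\int_0^T\!\!\int\partial_t\varphi(t,\omega)\,dg(t)(\omega)\,dt$$ $$+\int_0^T\!\!\iiint_{[0,\infty)^3}\frac{\Phi}{\sqrt{\omega_1\omega_2\omega_3}}\big[\varphi(t,\omega_4)+\varphi(t,\omega_3)-\varphi(t,\omega_1)-\varphi(t,\omega_2)\big]\,dg(t)(\omega_1)\,dg(t)(\omega_2)\,dg(t)(\omega_3)\,dt,$$ where $\omega_4=\omega_1+\omega_2-\omega_3$, $\Phi=\min\{\sqrt{\omega_1},\sqrt{\omega_2},\sqrt{\omega_3},\sqrt{(\omega_4)_+}\}$ (so the integrand is $0$ if $\omega_4<0$), and the integrand is extended by continuity from $(0,\infty)^3$ to $[0,\infty)^3$. It conserves mass and energy if $\int dg(t)=\int dg_0$ and $\int\omega\,dg(t)(\omega)=\int\omega\,dg_0(\omega)$ (in $[0,\infty]$) for all $t>0$.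 **Proposition.** There is a numerical constant $C>0$ such that for all $\rho<-1$, all $g_0\in\mathcal M^\rho_+$ and every weak solution $g$ with initial datum $g_0$ that conserves mass and energy, $$g(t)(\{0\})>0\qquad\text{for all } t>t_*:=C\big(\underline N_{1/2}(g_0)\,\overline N_{1/2}(g_0)\big)^{-1},$$ where $t_*=\infty$ (no claim) if $\underline N_{1/2}(g_0)=0$, and $t_*=0$ if $\underline N_{1/2}(g_0)>0$ and $\overline N_{1/2}(g_0)=\infty$. -/

import Mathlib

open MeasureTheory Set Filter Topology
open scoped NNReal ENNReal

namespace WaveKinetic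

noncomputable section

/-- The size `‖μ‖_ρ` of a nonnegative measure on `[0, ∞)`:
`sup_{R > 1} (1 + R)^(-ρ) R⁻¹ μ([R/2, R]) + μ([0, 1])`. -/
def rhoNorm (ρ : ℝ) (μ : Measure ℝ≥0) : ℝ≥0∞ :=
  (⨆ (R : ℝ≥0) (_ : 1 < R),
    ENNReal.ofReal ((1 + (R : ℝ)) ^ (-ρ) * (R : ℝ)⁻¹) * μ (Icc (R / 2) R)) + μ (Icc 0 1)

/-- `Φ / √(ω₁ω₂ω₃)` with `Φ = min {√ω₁, √ω₂, √ω₃, √ω₄}`, `ω₄ = ω₁ + ω₂ - ω₃` (and `√ω₄ = 0` if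
`ω₄ ≤ 0`), with the smallest factor cancelled. On `(0, ∞)³` this is literally that quotient, see
`collisionKernel_eq`. Where some `ωᵢ` vanishes the quotient reads `0 / 0`; the form below
makes `collisionIntegrand φ` on `[0, ∞)³` the extension by continuity of its values on
`(0, ∞)³`, so that a possible atom of the measure at `0` takes part in the interaction. -/
def collisionKernel (ω₁ ω₂ ω₃ : ℝ) : ℝ :=
  if ω₃ ≤ max ω₁ ω₂ then 1 / √(max (ω₁ * ω₂) (max (ω₁ * ω₃) (ω₂ * ω₃)))
  else √(ω₁ + ω₂ - ω₃) / √(ω₁ * ω₂ * ω₃)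

theorem collisionKernel_eq {ω₁ ω₂ ω₃ : ℝ} (h₁ : 0 < ω₁) (h₂ : 0 < ω₂) (h₃ : 0 < ω₃) :
    collisionKernel ω₁ ω₂ ω₃ =
      min (min √ω₁ √ω₂) (min √ω₃ √(ω₁ + ω₂ - ω₃)) / √(ω₁ * ω₂ * ω₃) := by
  have hd : √(ω₁ * ω₂ * ω₃) = √ω₁ * √ω₂ * √ω₃ := by
    rw [Real.sqrt_mul (by positivity), Real.sqrt_mul h₁.le]
  have p₁ := Real.sqrt_pos.2 h₁
  have p₂ := Real.sqrt_pos.2 h₂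
  have p₃ := Real.sqrt_pos.2 h₃
  unfold collisionKernel
  split_ifs with h
  · have key : ∀ a b c : ℝ, 0 < a → a ≤ b → a ≤ c →
        max (a * b) (max (a * c) (b * c)) = b * c := fun a b c ha hb hc => by
      rw [max_eq_right (b := b * c) (by nlinarith), max_eq_right (by nlinarith)]
    rcases le_total ω₁ ω₂ with h12 | h12
    · rw [max_eq_right h12] at h
      rcases le_total ω₁ ω₃ with h13 | h13
      · rw [key ω₁ ω₂ ω₃ h₁ h12 h13, min_eq_left (Real.sqrt_le_sqrt h12), min_eq_left
          (le_min (Real.sqrt_le_sqrt h13) (Real.sqrt_le_sqrt (by linarith))), hd,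
          Real.sqrt_mul h₂.le]
        field_simp
      · have := key ω₃ ω₁ ω₂ h₃ h13 h
        rw [show max (ω₁ * ω₂) (max (ω₁ * ω₃) (ω₂ * ω₃)) = ω₁ * ω₂ by
          rw [← this, mul_comm ω₃, mul_comm ω₃]; grind,
          min_eq_left (a := √ω₃) (Real.sqrt_le_sqrt (by linarith)), min_eq_right
          (le_min (Real.sqrt_le_sqrt h13) (Real.sqrt_le_sqrt h)), hd, Real.sqrt_mul h₁.le]
        field_simp
    · rw [max_eq_left h12] at h
      rcases le_total ω₂ ω₃ with h23 | h23
      · have := key ω₂ ω₁ ω₃ h₂ h12 h23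
        rw [show max (ω₁ * ω₂) (max (ω₁ * ω₃) (ω₂ * ω₃)) = ω₁ * ω₃ by
          rw [← this, mul_comm ω₂]; grind,
          min_eq_right (Real.sqrt_le_sqrt h12), min_eq_left
          (le_min (Real.sqrt_le_sqrt h23) (Real.sqrt_le_sqrt (by linarith))), hd,
          Real.sqrt_mul h₁.le]
        field_simp
      · have := key ω₃ ω₁ ω₂ h₃ h h23
        rw [show max (ω₁ * ω₂) (max (ω₁ * ω₃) (ω₂ * ω₃)) = ω₁ * ω₂ by
          rw [← this, mul_comm ω₃, mul_comm ω₃]; grind,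
          min_eq_left (a := √ω₃) (Real.sqrt_le_sqrt (by linarith)), min_eq_right
          (le_min (Real.sqrt_le_sqrt h) (Real.sqrt_le_sqrt h23)), hd, Real.sqrt_mul h₁.le]
        field_simp
  · rw [not_le, max_lt_iff] at h
    rw [min_eq_right (a := √ω₃) (Real.sqrt_le_sqrt (by linarith [h.1])), min_eq_right
      (le_min (Real.sqrt_le_sqrt (by linarith [h.2])) (Real.sqrt_le_sqrt (by linarith [h.1])))]

/-- The integrand of the collision integral against a test function `φ`. -/
def collisionIntegrand (φ : ℝ → ℝ) (ω₁ ω₂ ω₃ : ℝ) : ℝ :=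
  collisionKernel ω₁ ω₂ ω₃ * (φ (ω₁ + ω₂ - ω₃) + φ ω₃ - φ ω₁ - φ ω₂)

/-- The collision integral of the measure `μ` against `φ`, over `[0, ∞)³`. -/
def collision (φ : ℝ → ℝ) (μ : Measure ℝ≥0) : ℝ :=
  ∫ p : ℝ≥0 × ℝ≥0 × ℝ≥0, collisionIntegrand φ p.1 p.2.1 p.2.2 ∂(μ.prod (μ.prod μ))

/-- `g` (that is `g(t, ω) = √ω f(t, ω)`, as a family of measures on `[0, ∞)`) is a weak solution
with initial datum `g₀`. Only the values `g t` with `0 ≤ t` matter. Continuity in time is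
continuity for the weak topology of measures. -/
structure IsWeakSolution (ρ : ℝ) (g₀ : Measure ℝ≥0) (g : ℝ → Measure ℝ≥0) : Prop where
  initial : g 0 = g₀
  rhoNorm_lt_top : ∀ t, 0 ≤ t → rhoNorm ρ (g t) < ∞
  continuousOn : ∀ ψ : ℝ≥0 → ℝ, Continuous ψ → HasCompactSupport ψ →
    ContinuousOn (fun t => ∫ ω, ψ ω ∂(g t)) (Ici 0)
  weak_eq : ∀ φ : ℝ → ℝ → ℝ, ContDiff ℝ 2 (Function.uncurry φ) →
    HasCompactSupport (Function.uncurry φ) → ∀ T : ℝ, 0 < T →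
      ∫ ω : ℝ≥0, φ T ω ∂(g T) - ∫ ω : ℝ≥0, φ 0 ω ∂g₀ =
        (∫ t in (0 : ℝ)..T, ∫ ω : ℝ≥0, deriv (fun s => φ s ω) t ∂(g t)) +
          ∫ t in (0 : ℝ)..T, collision (φ t) (g t)

/-- Conservation of mass and energy, as identities in `[0, ∞]`. -/
structure ConservesMassEnergy (g₀ : Measure ℝ≥0) (g : ℝ → Measure ℝ≥0) : Prop where
  mass : ∀ t, 0 < t → g t univ = g₀ univ
  energy : ∀ t, 0 < t → ∫⁻ ω : ℝ≥0, (ω : ℝ≥0∞) ∂(g t) = ∫⁻ ω : ℝ≥0, (ω : ℝ≥0∞) ∂g₀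

/-- `N_α(g, ε) = ε^(-α) ∫_{[0, ε]} (1 - x/ε)² dg(x)`. -/
def N (α : ℝ) (g : Measure ℝ≥0) (ε : ℝ) : ℝ≥0∞ :=
  ENNReal.ofReal (ε ^ (-α)) *
    ∫⁻ x in {x : ℝ≥0 | (x : ℝ) ≤ ε}, ENNReal.ofReal ((1 - (x : ℝ) / ε) ^ 2) ∂g

/-- `inf_{0 < δ ≤ ε} N_α(g, δ)`. -/
def lowerNAt (α : ℝ) (g : Measure ℝ≥0) (ε : ℝ) : ℝ≥0∞ := ⨅ δ ∈ Ioc 0 ε, N α g δ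

/-- `sup_{0 < δ ≤ ε} N_α(g, δ)`. -/
def upperNAt (α : ℝ) (g : Measure ℝ≥0) (ε : ℝ) : ℝ≥0∞ := ⨆ δ ∈ Ioc 0 ε, N α g δ

/-- The limit of `lowerNAt α g ε` as `ε → 0+`, see `tendsto_lowerNAt`. -/
def lowerN (α : ℝ) (g : Measure ℝ≥0) : ℝ≥0∞ := ⨆ ε ∈ Ioi (0 : ℝ), lowerNAt α g ε

/-- The limit of `upperNAt α g ε` as `ε → 0+`, see `tendsto_upperNAt`. -/
def upperN (α : ℝ) (g : Measure ℝ≥0) : ℝ≥0∞ := ⨅ ε ∈ Ioi (0 : ℝ), upperNAt α g ε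

theorem tendsto_lowerNAt (α : ℝ) (g : Measure ℝ≥0) :
    Tendsto (lowerNAt α g) (𝓝[>] 0) (𝓝 (lowerN α g)) := by
  have h : Antitone (lowerNAt α g) := fun a b hab =>
    biInf_mono fun δ hδ => ⟨hδ.1, hδ.2.trans hab⟩
  have := h.tendsto_nhdsGT 0
  rwa [sSup_image] at this

theorem tendsto_upperNAt (α : ℝ) (g : Measure ℝ≥0) :
    Tendsto (upperNAt α g) (𝓝[>] 0) (𝓝 (upperN α g)) := by
  have h : Monotone (upperNAt α g) := fun a b hab =>
    biSup_mono fun δ hδ => ⟨hδ.1, hδ.2.trans hab⟩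
  have := h.tendsto_nhdsGT 0
  rwa [sInf_image] at this

end

end WaveKinetic

namespace WaveKinetic

noncomputable section

/-! Summed over the choice of the outgoing frequency, the collision integrand of a convex test
function is nonnegative: for frequencies `a ≤ b ≤ c` two of the three terms combine into the second
difference of the function at `c` with step `b - a` (`le_symmetrizedIntegrand`), and the third is
nonnegative by itself. Hence the integrals of the convex cutoffs `bump ε` increase in time, so a
lower bound of order `n √δ` on the initial mass of `[0, δ]`, for all small `δ`, persists.
Quantitatively, the mass near `0` acts as a catalyst: the collision integral of `bump ε` is at least
of order `ε⁻¹` times the mass of `[0, ε/8]` times the squared mass of the shell `(ε/4, ε]`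
(`le_collision_bump`). At scale `ε 4^(-k)` the persistent bound makes the first two factors `n 2^k /
√ε`. This growth in `k` allows the cutoffs to be added with weights `(2/3)^k`, and Cauchy-Schwarz
bounds the sum below by `n / √ε` times the square of the total shell mass. Without an atom at time
`T`, the mass inside the innermost of finitely many shells is negligible up to time `T`, so the
shells carry a fixed fraction of the weighted mass `F`. Then `F' ≥ A F²` with `A ~ n / √ε` and `F 0
≳ u √ε`, where `u` bounds `N_{1/2}` from below at the scale `ε / 2`. Such an `F` blows up by a time
of order `1 / (n u)`, although it is finite. Finally `n` and `u` tend to the lower and upper limits.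
-/

/-! ### Convex cutoffs of class `C²`. -/

theorem hasDerivAt_max_zero_pow (n : ℕ) (x : ℝ) :
    HasDerivAt (fun y : ℝ => max y 0 ^ (n + 2)) ((n + 2) * max x 0 ^ (n + 1)) x := by
  rcases lt_trichotomy x 0 with h | h | h
  · have : (fun y : ℝ => max y 0 ^ (n + 2)) =ᶠ[𝓝 x] fun _ => 0 := by
      filter_upwards [Iio_mem_nhds h] with y hy
      rw [max_eq_right (le_of_lt hy)]; simp
    rw [max_eq_right h.le]
    simpa using (hasDerivAt_const x (0 : ℝ)).congr_of_eventuallyEq this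
  · subst h
    rw [hasDerivAt_iff_isLittleO]
    simp only [max_self, ne_eq, Nat.add_eq_zero_iff, OfNat.ofNat_ne_zero, and_false,
      not_false_eq_true, zero_pow, sub_zero, one_ne_zero, mul_zero, smul_eq_mul]
    have h1 : (fun y : ℝ => max y 0 ^ (n + 2)) =O[𝓝 0] fun y : ℝ => y ^ (n + 2) := by
      refine Asymptotics.IsBigO.of_bound 1 (Eventually.of_forall fun y => ?_)
      rw [one_mul, norm_pow, norm_pow]
      gcongr
      rw [Real.norm_eq_abs, Real.norm_eq_abs, abs_of_nonneg (le_max_right _ _)]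
      exact max_le (le_abs_self y) (abs_nonneg y)
    refine h1.trans_isLittleO ?_
    simpa using Asymptotics.isLittleO_pow_pow (𝕜 := ℝ) (show 1 < n + 2 by omega)
  · have : (fun y : ℝ => max y 0 ^ (n + 2)) =ᶠ[𝓝 x] fun y => y ^ (n + 2) := by
      filter_upwards [Ioi_mem_nhds h] with y hy
      rw [max_eq_left (le_of_lt hy)]
    rw [max_eq_left h.le]
    simpa using (hasDerivAt_pow (n + 2) x).congr_of_eventuallyEq this

theorem contDiff_max_zero_pow_three : ContDiff ℝ 2 (fun x : ℝ => max x 0 ^ 3) := by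
  have h3 := hasDerivAt_max_zero_pow 1
  have h2 := hasDerivAt_max_zero_pow 0
  have d3 : deriv (fun x : ℝ => max x 0 ^ 3) = fun x => 3 * max x 0 ^ 2 := by
    funext x
    rw [(h3 x).deriv]
    norm_num
  have d2 : deriv (fun x : ℝ => max x 0 ^ 2) = fun x => 2 * max x 0 := by
    funext x
    rw [(h2 x).deriv]
    norm_num
  have c2 : ContDiff ℝ 1 (fun x : ℝ => max x 0 ^ 2) := by
    rw [show (1 : WithTop ℕ∞) = 0 + 1 by simp, contDiff_succ_iff_deriv]
    refine ⟨fun x => (h2 x).differentiableAt, by simp, ?_⟩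
    rw [d2, contDiff_zero]
    fun_prop
  rw [show (2 : WithTop ℕ∞) = 1 + 1 by norm_num, contDiff_succ_iff_deriv]
  refine ⟨fun x => (h3 x).differentiableAt, by simp, ?_⟩
  rw [d3]
  exact contDiff_const.mul c2

/-- Functions on `[0, ∞)` that extend to compactly supported `C²` functions on the line. -/
def IsTest (f : ℝ → ℝ) : Prop :=
  ∃ ψ : ℝ → ℝ, ContDiff ℝ 2 ψ ∧ HasCompactSupport ψ ∧ ∀ x, 0 ≤ x → ψ x = f x

theorem IsTest.zero : IsTest fun _ => 0 := ⟨fun _ => 0, contDiff_const, HasCompactSupport.zero,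
  fun _ _ => rfl⟩

theorem IsTest.add {f h : ℝ → ℝ} (hf : IsTest f) (hh : IsTest h) : IsTest fun x => f x + h x := by
  obtain ⟨ψ, h1, h2, h3⟩ := hf
  obtain ⟨χ, k1, k2, k3⟩ := hh
  exact ⟨fun x => ψ x + χ x, h1.add k1, h2.add k2, fun x hx => by simp [h3 x hx, k3 x hx]⟩

theorem IsTest.const_mul {f : ℝ → ℝ} (hf : IsTest f) (c : ℝ) : IsTest fun x => c * f x := by
  obtain ⟨ψ, h1, h2, h3⟩ := hf
  exact ⟨fun x => c * ψ x, contDiff_const.mul h1, h2.mul_left, fun x hx => by simp [h3 x hx]⟩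

theorem IsTest.sum {f : ℕ → ℝ → ℝ} (hf : ∀ k, IsTest (f k)) (s : Finset ℕ) :
    IsTest fun x => ∑ k ∈ s, f k x := by
  induction s using Finset.induction_on with
  | empty => simpa using IsTest.zero
  | insert a s ha ih => simpa [Finset.sum_insert ha] using (hf a).add ih

/-- The convex cutoff `(1 - x/ε)₊³`. -/
def bump (ε x : ℝ) : ℝ := max (1 - x / ε) 0 ^ 3

theorem bump_nonneg (ε x : ℝ) : 0 ≤ bump ε x := pow_nonneg (le_max_right _ _) 3

theorem bump_le_one {ε x : ℝ} (hε : 0 < ε) (hx : 0 ≤ x) : bump ε x ≤ 1 := by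
  refine pow_le_one₀ (le_max_right _ _) (max_le ?_ zero_le_one)
  have : 0 ≤ x / ε := by positivity
  linarith

theorem bump_eq_zero {ε x : ℝ} (hε : 0 < ε) (hx : ε ≤ x) : bump ε x = 0 := by
  have : 1 ≤ x / ε := (one_le_div hε).2 hx
  rw [bump, max_eq_right (by linarith)]
  simp

theorem bump_mono {ε δ x : ℝ} (hε : 0 < ε) (h : ε ≤ δ) (hx : 0 ≤ x) : bump ε x ≤ bump δ x := by
  unfold bump
  gcongr

theorem convexOn_bump (ε : ℝ) : ConvexOn ℝ univ (bump ε) := by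
  have h : ConvexOn ℝ univ (fun x : ℝ => max (1 - x / ε) 0) := by
    refine ConvexOn.sup ?_ (convexOn_const 0 convex_univ)
    refine ⟨convex_univ, fun x _ y _ a b _ _ hab => le_of_eq ?_⟩
    simp only [smul_eq_mul]
    linear_combination -hab
  exact h.pow (fun x _ => le_max_right _ _) 3

/-- The cube, unlike the square in `N`, is `C²` at `ε`. It is unbounded on the negative axis, so a
smooth factor truncates it there without changing it on `[0, ∞)`. -/
theorem isTest_bump {ε : ℝ} (hε : 0 < ε) : IsTest (bump ε) := by
  let θ : ContDiffBump (0 : ℝ) := ⟨ε, ε + 1, hε, by linarith⟩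
  have hb : ContDiff ℝ 2 (bump ε) :=
    contDiff_max_zero_pow_three.comp (contDiff_const.sub (contDiff_id.div_const ε))
  refine ⟨fun x => θ x * bump ε x, θ.contDiff.mul hb, θ.hasCompactSupport.mul_right,
    fun x hx => ?_⟩
  rcases le_total x ε with h | h
  · have : θ x = 1 := θ.one_of_mem_closedBall (by simpa [θ, abs_of_nonneg hx] using h)
    simp [this]
  · simp [bump_eq_zero hε h]

/-- A second difference of `bump ε` centred at a point of `[0, ε]`. -/
theorem bump_second_difference {ε c h : ℝ} (hε : 0 < ε) (hc : c ≤ ε) (hh : 0 ≤ h) :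
    (h / ε) ^ 3 ≤ bump ε (c + h) + bump ε (c - h) - 2 * bump ε c := by
  unfold bump
  rw [show 1 - (c + h) / ε = (1 - c / ε) - h / ε by ring,
    show 1 - (c - h) / ε = (1 - c / ε) + h / ε by ring]
  have hu : 0 ≤ 1 - c / ε := sub_nonneg.2 ((div_le_one hε).2 hc)
  have hk : 0 ≤ h / ε := by positivity
  generalize 1 - c / ε = u at *
  generalize h / ε = k at *
  rw [max_eq_left hu, max_eq_left (add_nonneg hu hk)]
  rcases le_total u k with h | h
  · rw [max_eq_right (by linarith)]
    nlinarith [mul_nonneg (mul_nonneg hu hu) (sub_nonneg.2 h), mul_nonneg (mul_nonneg hu hk) hk,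
      mul_nonneg (mul_nonneg hu hu) hk]
  · rw [max_eq_left (by linarith)]
    nlinarith [mul_nonneg (mul_nonneg hk hk) (sub_nonneg.2 h), pow_nonneg hk 3]

/-! ### Boundedness of the collision integrand. -/

/-- The four-point difference of a test function is controlled by the product of the increments. -/
theorem exists_four_point_bound {ψ : ℝ → ℝ} (h1 : ContDiff ℝ 2 ψ) (h2 : HasCompactSupport ψ) :
    ∃ L : ℝ, 0 ≤ L ∧ ∀ x h k : ℝ, |ψ (x + h + k) + ψ x - ψ (x + h) - ψ (x + k)| ≤ L * |h| * |k| := by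
  have hd : ContDiff ℝ 1 (deriv ψ) := by
    rw [show (2 : WithTop ℕ∞) = 1 + 1 by norm_num, contDiff_succ_iff_deriv] at h1
    exact h1.2.2
  obtain ⟨L, hL⟩ := hd.lipschitzWith_of_hasCompactSupport h2.deriv (by simp)
  have hdiff : Differentiable ℝ ψ := h1.differentiable (by simp)
  refine ⟨L, L.2, fun x h k => ?_⟩
  have key := Convex.norm_image_sub_le_of_norm_hasDerivWithin_le (s := univ)
    (f := fun y => ψ (y + h) - ψ y) (f' := fun y => deriv ψ (y + h) - deriv ψ y) (C := L * |h|)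
    (x := x) (y := x + k) (fun y _ => by
      refine (HasDerivAt.sub ?_ (hdiff y).hasDerivAt).hasDerivWithinAt
      exact (hdiff (y + h)).hasDerivAt.comp_add_const y h) (fun y _ => by
      have := hL.dist_le_mul (y + h) y
      simpa [Real.dist_eq] using this) convex_univ (mem_univ _) (mem_univ _)
  simp only [Real.norm_eq_abs] at key
  convert key using 2
  · rw [show x + h + k = x + k + h by ring]; ring
  · ring_nf

theorem collisionKernel_nonneg (a b c : ℝ) : 0 ≤ collisionKernel a b c := by
  unfold collisionKernel
  split_ifs <;> positivity

/-- If `c` is the largest frequency, then `a + b - c ≤ min a b`, so the second branch obeys the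
formula of the first as a bound. -/
theorem collisionKernel_le {a b c : ℝ} (ha : 0 ≤ a) (hb : 0 ≤ b) :
    collisionKernel a b c ≤ 1 / √(max (a * b) (max (a * c) (b * c))) := by
  unfold collisionKernel
  split_ifs with h
  · exact le_rfl
  rw [not_le, max_lt_iff] at h
  rcases ha.eq_or_lt with rfl | ha'
  · simp
  rcases hb.eq_or_lt with rfl | hb'
  · simp
  have hc : 0 < c := ha'.trans h.1
  rw [div_le_div_iff₀ (Real.sqrt_pos.2 (by positivity)) (Real.sqrt_pos.2 (by positivity)), one_mul]
  rcases le_total (a + b - c) 0 with h0 | h0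
  · rw [Real.sqrt_eq_zero_of_nonpos h0, zero_mul]; positivity
  rw [← Real.sqrt_mul h0]
  apply Real.sqrt_le_sqrt
  rcases le_total a b with hab | hab
  · rw [max_eq_right (a := a * c) (by gcongr), max_eq_right (by nlinarith [h.1])]
    nlinarith [mul_pos hb' hc]
  · rw [max_eq_left (a := a * c) (by gcongr), max_eq_right (by nlinarith [h.2])]
    nlinarith [mul_pos ha' hc]

/-- Only nonnegative frequencies interact. -/
theorem collisionKernel_eq_zero {a b c : ℝ} (ha : 0 ≤ a) (hb : 0 ≤ b) (h : a + b - c < 0) :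
    collisionKernel a b c = 0 := by
  unfold collisionKernel
  rw [if_neg, Real.sqrt_eq_zero_of_nonpos h.le, zero_div]
  rw [not_le, max_lt_iff]
  constructor <;> linarith

theorem collisionIntegrand_congr {f ψ : ℝ → ℝ} (h : ∀ x, 0 ≤ x → ψ x = f x) {a b c : ℝ}
    (ha : 0 ≤ a) (hb : 0 ≤ b) (hc : 0 ≤ c) :
    collisionIntegrand ψ a b c = collisionIntegrand f a b c := by
  unfold collisionIntegrand
  rcases lt_or_ge (a + b - c) 0 with h0 | h0
  · rw [collisionKernel_eq_zero ha hb h0, zero_mul, zero_mul]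
  · rw [h _ h0, h _ ha, h _ hb, h _ hc]

theorem abs_sub_mul_abs_sub_le {a b c : ℝ} (ha : 0 ≤ a) (hb : 0 ≤ b) (hc : 0 ≤ c)
    (h : 0 ≤ a + b - c) : |a - c| * |b - c| ≤ max (a * b) (max (a * c) (b * c)) := by
  rcases le_total a c with h1 | h1 <;> rcases le_total b c with h2 | h2
  -- Only here is `c ≤ a + b` needed: `(c - a) * (c - b) ≤ a * b` amounts to `c * (c - a - b) ≤ 0`.
  · rw [abs_of_nonpos (by linarith), abs_of_nonpos (by linarith)]
    exact le_max_of_le_left (by nlinarith)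
  · rw [abs_of_nonpos (by linarith), abs_of_nonneg (by linarith)]
    exact le_max_of_le_right (le_max_of_le_right (by nlinarith))
  · rw [abs_of_nonneg (by linarith), abs_of_nonpos (by linarith)]
    exact le_max_of_le_right (le_max_of_le_left (by nlinarith))
  · rw [abs_of_nonneg (by linarith), abs_of_nonneg (by linarith)]
    exact le_max_of_le_left (by nlinarith)

/-- The kernel is at most `1 / √P`, with `P` the largest pairwise product. The four-point difference
is `O(P)`, which cancels the singularity for `P ≤ 1`, and is bounded, which suffices for `P ≥ 1`. -/
theorem IsTest.exists_bound {f : ℝ → ℝ} (hf : IsTest f) :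
    ∃ B : ℝ, ∀ a b c : ℝ, 0 ≤ a → 0 ≤ b → 0 ≤ c → |collisionIntegrand f a b c| ≤ B := by
  obtain ⟨ψ, h1, h2, h3⟩ := hf
  obtain ⟨L, hL0, hL⟩ := exists_four_point_bound h1 h2
  obtain ⟨M, hM⟩ := h2.exists_bound_of_continuous h1.continuous
  have hM0 : 0 ≤ M := (norm_nonneg _).trans (hM 0)
  refine ⟨L + 4 * M, fun a b c ha hb hc => ?_⟩
  rw [← collisionIntegrand_congr h3 ha hb hc]
  rcases lt_or_ge (a + b - c) 0 with h0 | h0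
  · rw [collisionIntegrand, collisionKernel_eq_zero ha hb h0, zero_mul, abs_zero]; positivity
  set D := ψ (a + b - c) + ψ c - ψ a - ψ b with hD
  set P := max (a * b) (max (a * c) (b * c)) with hP
  have hP0 : 0 ≤ P := le_max_of_le_left (by positivity)
  have hD1 : |D| ≤ L * P := by
    have := hL c (a - c) (b - c)
    rw [show c + (a - c) + (b - c) = a + b - c by ring, show c + (a - c) = a by ring,
      show c + (b - c) = b by ring, mul_assoc] at this
    exact this.trans (by gcongr; exact abs_sub_mul_abs_sub_le ha hb hc h0)
  have hD2 : |D| ≤ 4 * M := by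
    have e1 := abs_le.1 (hM (a + b - c))
    have e2 := abs_le.1 (hM a)
    have e3 := abs_le.1 (hM b)
    have e4 := abs_le.1 (hM c)
    rw [abs_le]
    constructor <;> linarith [e1.1, e1.2, e2.1, e2.2, e3.1, e3.2, e4.1, e4.2]
  rw [collisionIntegrand, abs_mul, abs_of_nonneg (collisionKernel_nonneg _ _ _)]
  calc collisionKernel a b c * |D| ≤ 1 / √P * |D| := by
        gcongr; exact collisionKernel_le ha hb
    _ ≤ L + 4 * M := by
      rcases hP0.eq_or_lt with h | h
      · rw [← h]; simp; positivity
      have hs := Real.sqrt_pos.2 h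
      have hss := Real.sq_sqrt hP0
      rw [one_div, inv_mul_le_iff₀ hs]
      rcases le_total (√P) 1 with hl | hl
      · have : P ≤ √P := by nlinarith
        nlinarith [mul_nonneg hM0 hs.le, mul_le_mul_of_nonneg_left this hL0]
      · nlinarith [mul_nonneg hL0 hs.le]

@[fun_prop]
theorem measurable_collisionKernel :
    Measurable fun p : ℝ × ℝ × ℝ => collisionKernel p.1 p.2.1 p.2.2 := by
  unfold collisionKernel
  refine Measurable.ite (measurableSet_le (by fun_prop) (by fun_prop)) ?_ ?_
  · fun_prop
  · fun_prop

theorem measurable_collisionIntegrand {ψ : ℝ → ℝ} (h : Measurable ψ) :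
    Measurable fun p : ℝ≥0 × ℝ≥0 × ℝ≥0 => collisionIntegrand ψ p.1 p.2.1 p.2.2 := by
  unfold collisionIntegrand
  refine Measurable.mul ?_ (by fun_prop)
  exact measurable_collisionKernel.comp
    (g := fun p : ℝ × ℝ × ℝ => collisionKernel p.1 p.2.1 p.2.2)
    (f := fun p : ℝ≥0 × ℝ≥0 × ℝ≥0 => ((p.1 : ℝ), (p.2.1 : ℝ), (p.2.2 : ℝ))) (by fun_prop)

theorem IsTest.measurable_collisionIntegrand {f : ℝ → ℝ} (hf : IsTest f) :
    Measurable fun p : ℝ≥0 × ℝ≥0 × ℝ≥0 => collisionIntegrand f p.1 p.2.1 p.2.2 := by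
  obtain ⟨ψ, h1, h2, h3⟩ := hf
  convert _root_.WaveKinetic.measurable_collisionIntegrand h1.continuous.measurable using 2 with p
  exact (collisionIntegrand_congr h3 p.1.2 p.2.1.2 p.2.2.2).symm

theorem IsTest.integrable_collisionIntegrand {f : ℝ → ℝ} (hf : IsTest f)
    (ν : Measure (ℝ≥0 × ℝ≥0 × ℝ≥0)) [IsFiniteMeasure ν] :
    Integrable (fun p : ℝ≥0 × ℝ≥0 × ℝ≥0 => collisionIntegrand f p.1 p.2.1 p.2.2) ν := by
  obtain ⟨B, hB⟩ := hf.exists_bound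
  exact Integrable.of_bound hf.measurable_collisionIntegrand.aestronglyMeasurable B
    (Eventually.of_forall fun p => hB _ _ _ p.1.2 p.2.1.2 p.2.2.2)

theorem IsTest.integrable {f : ℝ → ℝ} (hf : IsTest f) (μ : Measure ℝ≥0) [IsFiniteMeasure μ] :
    Integrable (fun x : ℝ≥0 => f x) μ := by
  obtain ⟨ψ, h1, h2, h3⟩ := hf
  obtain ⟨M, hM⟩ := h2.exists_bound_of_continuous h1.continuous
  have : (fun x : ℝ≥0 => f x) = fun x : ℝ≥0 => ψ x := funext fun x => (h3 x x.2).symm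
  rw [this]
  exact Integrable.of_bound (h1.continuous.comp NNReal.continuous_coe).aestronglyMeasurable M
    (Eventually.of_forall fun x => hM x)

/-! ### Finiteness and conservation of the mass. -/

/-- The norm bounds the mass of the dyadic shell ending at `R` by a multiple of `R^(1 + ρ)`, and
these bounds form a convergent geometric series since `ρ < -1`. -/
theorem measure_univ_lt_top {ρ : ℝ} {μ : Measure ℝ≥0} (hρ : ρ < -1) (h : rhoNorm ρ μ < ∞) :
    μ univ < ∞ := by
  unfold rhoNorm at h
  set S : ℝ≥0∞ := ⨆ (R : ℝ≥0) (_ : 1 < R),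
    ENNReal.ofReal ((1 + (R : ℝ)) ^ (-ρ) * (R : ℝ)⁻¹) * μ (Icc (R / 2) R) with hS
  obtain ⟨hS1, hμ1⟩ := ENNReal.add_lt_top.1 h
  have hq0 : (0 : ℝ) < 2 ^ (1 + ρ) := by positivity
  have hq1 : (2 : ℝ) ^ (1 + ρ) < 1 := Real.rpow_lt_one_of_one_lt_of_neg (by norm_num) (by linarith)
  set q : ℝ := 2 ^ (1 + ρ) with hq
  have hk : ∀ k : ℕ, μ (Icc (2 ^ k) (2 ^ (k + 1))) ≤ S * ENNReal.ofReal q ^ (k + 1) := by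
    intro k
    have hR : (1 : ℝ≥0) < 2 ^ (k + 1) := one_lt_pow₀ (by norm_num) (by omega)
    have h1 := le_iSup₂ (f := fun (R : ℝ≥0) (_ : 1 < R) =>
      ENNReal.ofReal ((1 + (R : ℝ)) ^ (-ρ) * (R : ℝ)⁻¹) * μ (Icc (R / 2) R)) (2 ^ (k + 1)) hR
    rw [← hS, show (2 : ℝ≥0) ^ (k + 1) / 2 = 2 ^ k by rw [pow_succ]; simp] at h1
    have h2 : (q ^ (k + 1))⁻¹ ≤
        (1 + ((2 ^ (k + 1) : ℝ≥0) : ℝ)) ^ (-ρ) * ((2 ^ (k + 1) : ℝ≥0) : ℝ)⁻¹ := by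
      push_cast
      set R : ℝ := 2 ^ (k + 1) with hRd
      have hR0 : 0 < R := by positivity
      have e : (q ^ (k + 1))⁻¹ = R ^ (-ρ) * R⁻¹ := by
        rw [hq, hRd, ← Real.rpow_natCast, ← Real.rpow_mul (by norm_num), ← Real.rpow_neg (by norm_num),
          ← Real.rpow_natCast, ← Real.rpow_mul (by norm_num), ← Real.rpow_neg (by norm_num),
          ← Real.rpow_add (by norm_num)]
        congr 1
        ring
      rw [e]
      gcongr
      · linarith
      · linarith
    calc μ (Icc (2 ^ k) (2 ^ (k + 1)))
        = ENNReal.ofReal ((q ^ (k + 1))⁻¹) * μ (Icc (2 ^ k) (2 ^ (k + 1))) *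
            ENNReal.ofReal q ^ (k + 1) := by
          rw [mul_right_comm, ← ENNReal.ofReal_pow hq0.le, ← ENNReal.ofReal_mul (by positivity),
            inv_mul_cancel₀ (by positivity), ENNReal.ofReal_one, one_mul]
      _ ≤ S * ENNReal.ofReal q ^ (k + 1) := by
          gcongr
          exact le_trans (by gcongr) h1
  have hcover : (univ : Set ℝ≥0) ⊆ Icc 0 1 ∪ ⋃ k : ℕ, Icc (2 ^ k) (2 ^ (k + 1)) := by
    intro x _
    rcases le_total x 1 with hx | hx
    · exact Or.inl ⟨zero_le, hx⟩
    · obtain ⟨n, h1, h2⟩ := exists_nat_pow_near hx (by norm_num : (1 : ℝ≥0) < 2)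
      exact Or.inr (mem_iUnion.2 ⟨n, h1, h2.le⟩)
  have hsum : ∑' k : ℕ, S * ENNReal.ofReal q ^ (k + 1) < ∞ := by
    rw [ENNReal.tsum_mul_left]
    refine ENNReal.mul_lt_top hS1 ?_
    simp_rw [pow_succ]
    rw [ENNReal.tsum_mul_right, ENNReal.tsum_geometric]
    refine ENNReal.mul_lt_top (ENNReal.inv_lt_top.2 (tsub_pos_of_lt ?_)) ENNReal.ofReal_lt_top
    rw [← ENNReal.ofReal_one]
    exact (ENNReal.ofReal_lt_ofReal_iff (by norm_num)).2 hq1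
  calc μ univ ≤ μ (Icc 0 1) + ∑' k : ℕ, μ (Icc (2 ^ k) (2 ^ (k + 1))) :=
        (measure_mono hcover).trans ((measure_union_le _ _).trans (by
          gcongr; exact measure_iUnion_le _))
    _ ≤ μ (Icc 0 1) + ∑' k : ℕ, S * ENNReal.ofReal q ^ (k + 1) := by
        gcongr with k; exact hk k
    _ < ∞ := ENNReal.add_lt_top.2 ⟨hμ1, hsum⟩

theorem IsWeakSolution.isFiniteMeasure {ρ : ℝ} {g₀ : Measure ℝ≥0} {g : ℝ → Measure ℝ≥0}
    (hsol : IsWeakSolution ρ g₀ g) (hρ : ρ < -1) {t : ℝ} (ht : 0 ≤ t) : IsFiniteMeasure (g t) :=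
  ⟨measure_univ_lt_top hρ (hsol.rhoNorm_lt_top t ht)⟩

theorem ConservesMassEnergy.measure_univ {ρ : ℝ} {g₀ : Measure ℝ≥0} {g : ℝ → Measure ℝ≥0}
    (hc : ConservesMassEnergy g₀ g) (hsol : IsWeakSolution ρ g₀ g) {t : ℝ} (ht : 0 ≤ t) :
    g t univ = g₀ univ := by
  rcases ht.eq_or_lt with rfl | h
  · rw [hsol.initial]
  · exact hc.mass t h

/-! ### Measurability in time and the integrated equation. -/

/-- Continuous compactly supported functions decreasing to the indicator of `[0, a]`. -/
def closedCutoff (a : ℝ≥0) (n : ℕ) (x : ℝ≥0) : ℝ := max (1 - n * max ((x : ℝ) - a) 0) 0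

theorem continuous_closedCutoff (a : ℝ≥0) (n : ℕ) : Continuous (closedCutoff a n) := by
  unfold closedCutoff
  fun_prop

/-- The shift to `n + 1` is needed: at index `0` the cutoff is the constant `1`. -/
theorem hasCompactSupport_closedCutoff (a : ℝ≥0) (n : ℕ) :
    HasCompactSupport (closedCutoff a (n + 1)) := by
  refine HasCompactSupport.of_support_subset_isCompact (isCompact_Icc (a := 0) (b := a + 1)) ?_
  intro x hx
  refine ⟨zero_le, ?_⟩
  by_contra hlt
  rw [not_le, ← NNReal.coe_lt_coe] at hlt
  push_cast at hlt
  apply hx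
  unfold closedCutoff
  rw [max_eq_left (a := (x : ℝ) - a) (by linarith), max_eq_right]
  push_cast
  nlinarith [(Nat.cast_nonneg n : (0 : ℝ) ≤ n)]

theorem tendsto_closedCutoff (a x : ℝ≥0) :
    Tendsto (fun n : ℕ => closedCutoff a (n + 1) x) atTop
      (𝓝 ((Iic a).indicator (fun _ => (1 : ℝ)) x)) := by
  by_cases h : x ≤ a
  · have : ∀ n : ℕ, closedCutoff a n x = 1 := fun n => by
      have h' : (x : ℝ) ≤ a := h
      simp [closedCutoff, max_eq_right (sub_nonpos.2 h')]
    simp [this, h]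
  · have h' : (a : ℝ) < x := lt_of_not_ge h
    rw [indicator_of_notMem (by simpa using h)]
    refine tendsto_const_nhds.congr' ?_
    obtain ⟨m, hm⟩ := exists_nat_gt (1 / ((x : ℝ) - a))
    filter_upwards [eventually_ge_atTop m] with n hn
    have hd : 0 < (x : ℝ) - a := by linarith
    rw [div_lt_iff₀ hd] at hm
    have hmn : (m : ℝ) ≤ n := by exact_mod_cast hn
    unfold closedCutoff
    rw [max_eq_left hd.le, max_eq_right]
    push_cast
    nlinarith

theorem closedCutoff_mem_Icc (a : ℝ≥0) (n : ℕ) (x : ℝ≥0) : closedCutoff a n x ∈ Icc (0 : ℝ) 1 := by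
  refine ⟨le_max_right _ _, max_le ?_ zero_le_one⟩
  have : 0 ≤ (n : ℝ) * max ((x : ℝ) - a) 0 := by positivity
  linarith

section

variable {ρ : ℝ} {g₀ : Measure ℝ≥0} {g : ℝ → Measure ℝ≥0}

/-- The mass of `[0, a]` is a pointwise limit of functions continuous in time, and such intervals
form a generating π-system. The argument `max t 0` extends the family to all real times, as kernels
on `ℝ` require. -/
theorem IsWeakSolution.measurable_family (hsol : IsWeakSolution ρ g₀ g) (hρ : ρ < -1)
    (hc : ConservesMassEnergy g₀ g) : Measurable fun t : ℝ => g (max t 0) := by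
  have hfin : ∀ t : ℝ, IsFiniteMeasure (g (max t 0)) := fun t =>
    hsol.isFiniteMeasure hρ (le_max_right _ _)
  refine Measurable.measure_of_isPiSystem (S := range Iic)
    (by rw [BorelSpace.measurable_eq (α := ℝ≥0)]; exact borel_eq_generateFrom_Iic ℝ≥0)
    isPiSystem_Iic ?_ ?_
  · rintro _ ⟨a, rfl⟩
    have hlim : ∀ t : ℝ, Tendsto (fun n : ℕ => ∫ x, closedCutoff a (n + 1) x ∂(g (max t 0))) atTop
        (𝓝 ((g (max t 0)).real (Iic a))) := by
      intro t
      rw [← integral_indicator_one (measurableSet_Iic)]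
      refine tendsto_integral_of_dominated_convergence (fun _ => (1 : ℝ))
        (fun n => (continuous_closedCutoff a (n + 1)).aestronglyMeasurable) (integrable_const _)
        (fun n => Eventually.of_forall fun x => ?_)
        (Eventually.of_forall fun x => tendsto_closedCutoff a x)
      have := closedCutoff_mem_Icc a (n + 1) x
      rw [Real.norm_eq_abs, abs_of_nonneg this.1]
      exact this.2
    have hm : Measurable fun t : ℝ => (g (max t 0)).real (Iic a) := by
      refine measurable_of_tendsto_metrizable (fun n => ?_) (tendsto_pi_nhds.2 hlim)
      have := hsol.continuousOn _ (continuous_closedCutoff a (n + 1))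
        (hasCompactSupport_closedCutoff a n)
      exact (this.comp_continuous (f := fun t : ℝ => max t 0) (by fun_prop)
        (fun t => mem_Ici.2 (le_max_right _ _))).measurable
    simpa using hm.ennreal_ofReal
  · simp_rw [hc.measure_univ hsol (le_max_right _ _)]
    exact measurable_const

theorem IsWeakSolution.measurable_collision (hsol : IsWeakSolution ρ g₀ g) (hρ : ρ < -1)
    (hc : ConservesMassEnergy g₀ g) {f : ℝ → ℝ} (hf : IsTest f) :
    Measurable fun t : ℝ => collision f (g (max t 0)) := by
  let κ : ProbabilityTheory.Kernel ℝ ℝ≥0 :=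
    ⟨fun t => g (max t 0), hsol.measurable_family hρ hc⟩
  have hfin0 : IsFiniteMeasure g₀ := hsol.initial ▸ hsol.isFiniteMeasure hρ le_rfl
  have : ProbabilityTheory.IsFiniteKernel κ := ⟨⟨g₀ univ, measure_lt_top _ _, fun t =>
    (hc.measure_univ hsol (le_max_right _ _)).le⟩⟩
  have h := (hf.measurable_collisionIntegrand.stronglyMeasurable.integral_kernel
    (κ := ProbabilityTheory.Kernel.prod κ (ProbabilityTheory.Kernel.prod κ κ))).measurable
  simp_rw [ProbabilityTheory.Kernel.prod_apply] at h
  exact h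

theorem IsWeakSolution.intervalIntegrable_collision (hsol : IsWeakSolution ρ g₀ g) (hρ : ρ < -1)
    (hc : ConservesMassEnergy g₀ g) {f : ℝ → ℝ} (hf : IsTest f) {s t : ℝ} (hs : 0 ≤ s)
    (ht : 0 ≤ t) : IntervalIntegrable (fun τ => collision f (g τ)) volume s t := by
  obtain ⟨B, hB⟩ := hf.exists_bound
  have h : IntervalIntegrable (fun τ => collision f (g (max τ 0))) volume s t := by
    rw [intervalIntegrable_iff]
    refine Measure.integrableOn_of_bounded (M := B * g₀.real univ ^ 3) (by simp)
      (hsol.measurable_collision hρ hc hf).aestronglyMeasurable (Eventually.of_forall fun τ => ?_)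
    have hτ : (0 : ℝ) ≤ max τ 0 := le_max_right _ _
    have := hsol.isFiniteMeasure hρ hτ
    refine (norm_integral_le_of_norm_le_const (C := B) (Eventually.of_forall fun p =>
      hB _ _ _ p.1.2 p.2.1.2 p.2.2.2)).trans (le_of_eq ?_)
    rw [← univ_prod_univ, measureReal_prod_prod, ← univ_prod_univ, measureReal_prod_prod,
      Measure.real, hc.measure_univ hsol hτ, Measure.real]
    ring
  refine h.congr (fun τ hτ => ?_)
  have : 0 ≤ τ := (le_min hs ht).trans hτ.1.le
  simp [max_eq_left this]

theorem collision_congr {f ψ : ℝ → ℝ} (h : ∀ x, 0 ≤ x → ψ x = f x) (μ : Measure ℝ≥0) :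
    collision ψ μ = collision f μ :=
  integral_congr_ae (Eventually.of_forall fun p =>
    collisionIntegrand_congr h p.1.2 p.2.1.2 p.2.2.2)

theorem IsWeakSolution.integral_sub_initial (hsol : IsWeakSolution ρ g₀ g) {f : ℝ → ℝ}
    (hf : IsTest f) {T : ℝ} (hT : 0 ≤ T) :
    ∫ ω : ℝ≥0, f ω ∂(g T) - ∫ ω : ℝ≥0, f ω ∂(g 0) = ∫ t in (0 : ℝ)..T, collision f (g t) := by
  rcases hT.eq_or_lt with rfl | hT
  · simp
  obtain ⟨ψ, h1, h2, h3⟩ := hf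
  -- The weak equation requires compact support in time as well; `θ` is `1` near every point of `[0,
  -- T]`, so the term with the time derivative vanishes.
  let θ : ContDiffBump (0 : ℝ) := ⟨T + 1, T + 2, by linarith, by linarith⟩
  have hθ : ∀ t ∈ Icc (0 : ℝ) T, θ =ᶠ[𝓝 t] fun _ => 1 := by
    intro t ht
    have : Metric.ball (0 : ℝ) (T + 1) ∈ 𝓝 t := by
      refine Metric.isOpen_ball.mem_nhds ?_
      rw [Metric.mem_ball, Real.dist_eq, sub_zero, abs_of_nonneg ht.1]
      linarith [ht.2]
    filter_upwards [this] with s hs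
    exact θ.one_of_mem_closedBall (Metric.ball_subset_closedBall hs)
  have hθ1 : ∀ t ∈ Icc (0 : ℝ) T, θ t = 1 := fun t ht => (hθ t ht).self_of_nhds
  have key := hsol.weak_eq (fun t ω => θ t * ψ ω)
    ((θ.contDiff.comp contDiff_fst).mul (h1.comp contDiff_snd)) (by
      refine HasCompactSupport.of_support_subset_isCompact
        (θ.hasCompactSupport.isCompact.prod h2.isCompact) ?_
      rintro ⟨t, x⟩ hx
      have hx' : θ t * ψ x ≠ 0 := hx
      exact ⟨subset_tsupport _ (left_ne_zero_of_mul hx'),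
        subset_tsupport _ (right_ne_zero_of_mul hx')⟩) T hT
  have hd : ∫ t in (0 : ℝ)..T, ∫ ω : ℝ≥0, deriv (fun s => θ s * ψ ω) t ∂(g t) = 0 := by
    rw [intervalIntegral.integral_congr (g := fun _ => (0 : ℝ))]
    · simp
    · intro t ht
      rw [uIcc_of_le hT.le] at ht
      have : ∀ ω : ℝ≥0, deriv (fun s => θ s * ψ ω) t = 0 := fun ω => by
        have : (fun s => θ s * ψ ω) =ᶠ[𝓝 t] fun _ => ψ ω := by
          filter_upwards [hθ t ht] with s hs
          rw [hs, one_mul]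
        rw [this.deriv_eq, deriv_const]
      simp [this]
  rw [hd, zero_add, ← hsol.initial] at key
  simp only [hθ1 0 ⟨le_rfl, hT.le⟩, hθ1 T ⟨hT.le, le_rfl⟩, one_mul] at key
  have e : ∀ μ : Measure ℝ≥0, ∫ ω : ℝ≥0, ψ ω ∂μ = ∫ ω : ℝ≥0, f ω ∂μ := fun μ =>
    integral_congr_ae (Eventually.of_forall fun ω => h3 ω ω.2)
  rw [e, e] at key
  rw [key]
  refine intervalIntegral.integral_congr fun t ht => ?_
  rw [uIcc_of_le hT.le] at ht
  simp only [hθ1 t ht, one_mul]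
  exact collision_congr h3 _

theorem IsWeakSolution.integral_sub (hsol : IsWeakSolution ρ g₀ g) (hρ : ρ < -1)
    (hc : ConservesMassEnergy g₀ g) {f : ℝ → ℝ} (hf : IsTest f) {s t : ℝ} (hs : 0 ≤ s)
    (ht : 0 ≤ t) :
    ∫ ω : ℝ≥0, f ω ∂(g t) - ∫ ω : ℝ≥0, f ω ∂(g s) = ∫ τ in s..t, collision f (g τ) := by
  have := intervalIntegral.integral_interval_sub_left
    (hsol.intervalIntegrable_collision hρ hc hf le_rfl ht)
    (hsol.intervalIntegrable_collision hρ hc hf le_rfl hs)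
  rw [← this, ← hsol.integral_sub_initial hf ht, ← hsol.integral_sub_initial hf hs]
  ring

/-- A lower bound on the collision integral is a lower bound on the growth rate. -/
theorem IsWeakSolution.mul_le_integral_sub (hsol : IsWeakSolution ρ g₀ g) (hρ : ρ < -1)
    (hc : ConservesMassEnergy g₀ g) {f : ℝ → ℝ} (hf : IsTest f) {s t A : ℝ} (hs : 0 ≤ s)
    (hst : s ≤ t) (hA : ∀ τ ∈ Icc s t, A ≤ collision f (g τ)) :
    (t - s) * A ≤ ∫ ω : ℝ≥0, f ω ∂(g t) - ∫ ω : ℝ≥0, f ω ∂(g s) := by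
  rw [hsol.integral_sub hρ hc hf hs (hs.trans hst)]
  have := intervalIntegral.integral_mono_on hst (intervalIntegrable_const (c := A))
    (hsol.intervalIntegrable_collision hρ hc hf hs (hs.trans hst)) hA
  simpa using this

end

/-! ### Convexity and the symmetrized collision integrand. -/

theorem convexOn_four_point {f : ℝ → ℝ} (hf : ConvexOn ℝ univ f) {x y h : ℝ} (hxy : x ≤ y)
    (hh : 0 ≤ h) : f (x + h) + f y ≤ f x + f (y + h) := by
  rcases (by linarith : x ≤ y + h).eq_or_lt with e | hlt
  · rw [show h = 0 by linarith, show y = x by linarith]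
    simp
  have hd : 0 < y + h - x := by linarith
  have w1 : 0 ≤ (y - x) / (y + h - x) := div_nonneg (by linarith) hd.le
  have w2 : 0 ≤ h / (y + h - x) := div_nonneg hh hd.le
  have hw : (y - x) / (y + h - x) + h / (y + h - x) = 1 := by field_simp; ring
  have h1 := hf.2 (mem_univ x) (mem_univ (y + h)) w1 w2 hw
  have h2 := hf.2 (mem_univ x) (mem_univ (y + h)) w2 w1 (by rw [add_comm, hw])
  simp only [smul_eq_mul] at h1 h2
  rw [show (y - x) / (y + h - x) * x + h / (y + h - x) * (y + h) = x + h by field_simp; ring] at h1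
  rw [show h / (y + h - x) * x + (y - x) / (y + h - x) * (y + h) = y by field_simp; ring] at h2
  calc f (x + h) + f y ≤ _ := add_le_add h1 h2
    _ = ((y - x) / (y + h - x) + h / (y + h - x)) * (f x + f (y + h)) := by ring
    _ = _ := by rw [hw, one_mul]

/-- The sum of the collision integrand over the three choices of the outgoing frequency. -/
def symmetrizedIntegrand (f : ℝ → ℝ) (a b c : ℝ) : ℝ :=
  collisionIntegrand f a b c + collisionIntegrand f a c b + collisionIntegrand f b c a

theorem collisionIntegrand_swap (f : ℝ → ℝ) (a b c : ℝ) :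
    collisionIntegrand f a b c = collisionIntegrand f b a c := by
  unfold collisionIntegrand collisionKernel
  rw [max_comm a b, mul_comm a b, max_comm (a * c), add_comm a b]
  ring

theorem symmetrizedIntegrand_swap_right (f : ℝ → ℝ) (a b c : ℝ) :
    symmetrizedIntegrand f a b c = symmetrizedIntegrand f a c b := by
  unfold symmetrizedIntegrand
  rw [collisionIntegrand_swap f b c a]
  ring

theorem symmetrizedIntegrand_swap_left (f : ℝ → ℝ) (a b c : ℝ) :
    symmetrizedIntegrand f a b c = symmetrizedIntegrand f b a c := by
  unfold symmetrizedIntegrand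
  rw [collisionIntegrand_swap f a b c]
  ring

/-- The terms with outgoing `a` and outgoing `b` share the kernel `1 / √(b * c)`, and in their sum
`f a` and `f b` cancel. The term with outgoing `c` is dropped: the pair `a + b - c, c` is more
spread out than `a, b`. -/
theorem le_symmetrizedIntegrand {f : ℝ → ℝ} (hf : ConvexOn ℝ univ f) {a b c : ℝ} (ha : 0 ≤ a)
    (hab : a ≤ b) (hbc : b ≤ c) :
    1 / √(b * c) * (f (c + (b - a)) + f (c - (b - a)) - 2 * f c) ≤
      symmetrizedIntegrand f a b c := by
  have hb := ha.trans hab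
  have hc := hb.trans hbc
  have k1 : collisionKernel b c a = 1 / √(b * c) := by
    unfold collisionKernel
    rw [if_pos ((hab.trans hbc).trans (le_max_right _ _)), max_eq_left]
    exact max_le (by nlinarith) (by nlinarith)
  have k2 : collisionKernel a c b = 1 / √(b * c) := by
    unfold collisionKernel
    rw [if_pos (hbc.trans (le_max_right _ _)), max_eq_right (a := a * b) (by nlinarith),
      max_eq_right (by nlinarith), mul_comm]
  have k3 : 0 ≤ collisionIntegrand f a b c := by
    refine mul_nonneg (collisionKernel_nonneg _ _ _) ?_
    have := convexOn_four_point hf (show a + b - c ≤ b by linarith) (show 0 ≤ c - b by linarith)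
    rw [show a + b - c + (c - b) = a by ring, show b + (c - b) = c by ring] at this
    linarith
  unfold symmetrizedIntegrand
  have e1 : collisionIntegrand f a c b + collisionIntegrand f b c a =
      1 / √(b * c) * (f (c + (b - a)) + f (c - (b - a)) - 2 * f c) := by
    unfold collisionIntegrand
    rw [k1, k2, show a + c - b = c - (b - a) by ring, show b + c - a = c + (b - a) by ring]
    ring
  linarith

theorem symmetrizedIntegrand_nonneg {f : ℝ → ℝ} (hf : ConvexOn ℝ univ f) {a b c : ℝ} (ha : 0 ≤ a)
    (hb : 0 ≤ b) (hc : 0 ≤ c) : 0 ≤ symmetrizedIntegrand f a b c := by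
  have key : ∀ x y z : ℝ, 0 ≤ x → x ≤ y → y ≤ z → 0 ≤ symmetrizedIntegrand f x y z := by
    intro x y z hx hxy hyz
    refine le_trans (mul_nonneg (by positivity) ?_) (le_symmetrizedIntegrand hf hx hxy hyz)
    have := convexOn_four_point hf (show z - (y - x) ≤ z by linarith) (show 0 ≤ y - x by linarith)
    rw [sub_add_cancel] at this
    linarith
  rcases le_total a b with h1 | h1 <;> rcases le_total b c with h2 | h2 <;>
    rcases le_total a c with h3 | h3
  · exact key _ _ _ ha h1 h2
  · exact key _ _ _ ha h1 h2
  · rw [symmetrizedIntegrand_swap_right]; exact key _ _ _ ha h3 h2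
  · rw [symmetrizedIntegrand_swap_right, symmetrizedIntegrand_swap_left]; exact key _ _ _ hc h3 h1
  · rw [symmetrizedIntegrand_swap_left]; exact key _ _ _ hb h1 h3
  · rw [symmetrizedIntegrand_swap_left, symmetrizedIntegrand_swap_right]; exact key _ _ _ hb h2 h3
  · rw [symmetrizedIntegrand_swap_right, symmetrizedIntegrand_swap_left,
      symmetrizedIntegrand_swap_right]; exact key _ _ _ hc h2 h1
  · rw [symmetrizedIntegrand_swap_right, symmetrizedIntegrand_swap_left,
      symmetrizedIntegrand_swap_right]; exact key _ _ _ hc h2 h1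

theorem le_symmetrizedIntegrand_bump {ε a b c : ℝ} (hε : 0 < ε) (ha : 0 ≤ a) (ha' : a ≤ ε / 8)
    (hb : ε / 4 < b) (hb' : b ≤ ε) (hc : ε / 4 < c) (hc' : c ≤ ε) :
    1 / (512 * ε) ≤ symmetrizedIntegrand (bump ε) a b c := by
  wlog hbc : b ≤ c generalizing b c
  · rw [symmetrizedIntegrand_swap_right]
    exact this hc hc' hb hb' (le_of_not_ge hbc)
  refine le_trans ?_ (le_symmetrizedIntegrand (convexOn_bump ε) ha (by linarith) hbc)
  have h1 := bump_second_difference hε hc' (show 0 ≤ b - a by linarith)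
  have h2 : (1 : ℝ) / 512 ≤ ((b - a) / ε) ^ 3 := by
    rw [show (1 : ℝ) / 512 = (1 / 8) ^ 3 by norm_num]
    -- The gap between `[0, ε/8]` and `(ε/4, ε]` has length `ε / 8`.
    have : 1 / 8 ≤ (b - a) / ε := by
      rw [le_div_iff₀ hε]
      linarith
    gcongr
  have h3 : 1 / ε ≤ 1 / √(b * c) := by
    have : 0 < b * c := mul_pos (by linarith) (by linarith)
    gcongr
    rw [Real.sqrt_le_left hε.le]
    nlinarith
  calc 1 / (512 * ε) = 1 / ε * (1 / 512) := by field_simp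
    _ ≤ _ := mul_le_mul h3 (h2.trans h1) (by norm_num) (by positivity)

/-! ### The collision integral against convex functions. -/

section

variable (μ : Measure ℝ≥0) [IsFiniteMeasure μ]

theorem measurePreserving_swap_right :
    MeasurePreserving (fun p : ℝ≥0 × ℝ≥0 × ℝ≥0 => (p.1, p.2.2, p.2.1))
      (μ.prod (μ.prod μ)) (μ.prod (μ.prod μ)) :=
  (MeasurePreserving.id μ).prod (Measure.measurePreserving_swap (μ := μ) (ν := μ))

theorem measurePreserving_rotate :
    MeasurePreserving (fun p : ℝ≥0 × ℝ≥0 × ℝ≥0 => (p.2.1, p.2.2, p.1))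
      (μ.prod (μ.prod μ)) (μ.prod (μ.prod μ)) :=
  (measurePreserving_prodAssoc μ μ μ).comp
    (Measure.measurePreserving_swap (μ := μ) (ν := μ.prod μ))

theorem integrable_symmetrizedIntegrand {f : ℝ → ℝ} (hf : IsTest f) :
    Integrable (fun p : ℝ≥0 × ℝ≥0 × ℝ≥0 => symmetrizedIntegrand f p.1 p.2.1 p.2.2)
      (μ.prod (μ.prod μ)) := by
  have h := hf.integrable_collisionIntegrand (μ.prod (μ.prod μ))
  exact (h.add ((measurePreserving_swap_right μ).integrable_comp_of_integrable h)).add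
    ((measurePreserving_rotate μ).integrable_comp_of_integrable h)

theorem integral_symmetrizedIntegrand {f : ℝ → ℝ} (hf : IsTest f) :
    ∫ p : ℝ≥0 × ℝ≥0 × ℝ≥0, symmetrizedIntegrand f p.1 p.2.1 p.2.2 ∂(μ.prod (μ.prod μ)) =
      3 * collision f μ := by
  have h := hf.integrable_collisionIntegrand (μ.prod (μ.prod μ))
  have h1 := (measurePreserving_swap_right μ).integrable_comp_of_integrable h
  have h2 := (measurePreserving_rotate μ).integrable_comp_of_integrable h
  have comp : ∀ φ : ℝ≥0 × ℝ≥0 × ℝ≥0 → ℝ≥0 × ℝ≥0 × ℝ≥0,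
      MeasurePreserving φ (μ.prod (μ.prod μ)) (μ.prod (μ.prod μ)) →
      ∫ p, collisionIntegrand f (φ p).1 (φ p).2.1 (φ p).2.2 ∂(μ.prod (μ.prod μ)) =
        collision f μ := by
    intro φ hφ
    unfold collision
    conv_rhs => rw [← hφ.map_eq]
    rw [integral_map hφ.aemeasurable hf.measurable_collisionIntegrand.aestronglyMeasurable]
  have e1 := comp _ (measurePreserving_swap_right μ)
  have e2 := comp _ (measurePreserving_rotate μ)
  unfold symmetrizedIntegrand
  have h1' : Integrable (fun p : ℝ≥0 × ℝ≥0 × ℝ≥0 => collisionIntegrand f p.1 p.2.2 p.2.1)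
      (μ.prod (μ.prod μ)) := h1
  have h2' : Integrable (fun p : ℝ≥0 × ℝ≥0 × ℝ≥0 => collisionIntegrand f p.2.1 p.2.2 p.1)
      (μ.prod (μ.prod μ)) := h2
  rw [integral_add (by exact h.add h1') h2', integral_add h h1', e1, e2]
  unfold collision
  ring

theorem collision_nonneg {f : ℝ → ℝ} (hf : IsTest f) (hconv : ConvexOn ℝ univ f) :
    0 ≤ collision f μ := by
  have : 0 ≤ 3 * collision f μ := by
    rw [← integral_symmetrizedIntegrand μ hf]
    exact integral_nonneg fun p => symmetrizedIntegrand_nonneg hconv p.1.2 p.2.1.2 p.2.2.2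
  linarith

theorem le_collision_bump {ε : ℝ} (hε : 0 < ε) :
    1 / (1536 * ε) * μ.real {x : ℝ≥0 | (x : ℝ) ≤ ε / 8} *
      μ.real {x : ℝ≥0 | ε / 4 < (x : ℝ) ∧ (x : ℝ) ≤ ε} ^ 2 ≤ collision (bump ε) μ := by
  set A : Set ℝ≥0 := {x : ℝ≥0 | (x : ℝ) ≤ ε / 8}
  set B : Set ℝ≥0 := {x : ℝ≥0 | ε / 4 < (x : ℝ) ∧ (x : ℝ) ≤ ε}
  have hA : MeasurableSet A := measurableSet_le (by fun_prop) (by fun_prop)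
  have hB : MeasurableSet B := MeasurableSet.inter (s₁ := {x : ℝ≥0 | ε / 4 < (x : ℝ)})
    (s₂ := {x : ℝ≥0 | (x : ℝ) ≤ ε}) (measurableSet_lt (by fun_prop) (by fun_prop))
    (measurableSet_le (by fun_prop) (by fun_prop))
  have hm : MeasurableSet (A ×ˢ B ×ˢ B) := hA.prod (hB.prod hB)
  have h1 : ∫ p, (A ×ˢ B ×ˢ B).indicator (fun _ => 1 / (512 * ε)) p ∂(μ.prod (μ.prod μ)) ≤
      3 * collision (bump ε) μ := by
    rw [← integral_symmetrizedIntegrand μ (isTest_bump hε)]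
    refine integral_mono ((integrable_const _).indicator hm)
      (integrable_symmetrizedIntegrand μ (isTest_bump hε)) fun p => ?_
    by_cases hp : p ∈ A ×ˢ B ×ˢ B
    · rw [indicator_of_mem hp]
      exact le_symmetrizedIntegrand_bump hε p.1.2 hp.1 hp.2.1.1 hp.2.1.2 hp.2.2.1 hp.2.2.2
    · rw [indicator_of_notMem hp]
      exact symmetrizedIntegrand_nonneg (convexOn_bump ε) p.1.2 p.2.1.2 p.2.2.2
  rw [integral_indicator_const _ hm, measureReal_prod_prod, measureReal_prod_prod,
    smul_eq_mul] at h1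
  have e : 1 / (1536 * ε) * μ.real A * μ.real B ^ 2 =
      (μ.real A * (μ.real B * μ.real B) * (1 / (512 * ε))) / 3 := by
    field_simp
    ring
  rw [e]
  linarith

end

/-! ### Cutoff integrals, mass near the origin and shells. -/

section

variable (μ : Measure ℝ≥0) [IsFiniteMeasure μ]

theorem measurableSet_coe_le (ε : ℝ) : MeasurableSet {x : ℝ≥0 | (x : ℝ) ≤ ε} :=
  measurableSet_le (by fun_prop) (by fun_prop)

theorem integral_bump_le_measureReal {ε : ℝ} (hε : 0 < ε) :
    ∫ x : ℝ≥0, bump ε x ∂μ ≤ μ.real {x : ℝ≥0 | (x : ℝ) ≤ ε} := by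
  rw [← integral_indicator_one (measurableSet_coe_le ε)]
  refine integral_mono ((isTest_bump hε).integrable μ)
    ((integrable_const _).indicator (measurableSet_coe_le ε)) fun x => ?_
  by_cases h : (x : ℝ) ≤ ε
  · rw [indicator_of_mem (show x ∈ {x : ℝ≥0 | (x : ℝ) ≤ ε} from h)]
    exact bump_le_one hε x.2
  · rw [indicator_of_notMem (show x ∉ {x : ℝ≥0 | (x : ℝ) ≤ ε} from h)]
    exact (bump_eq_zero hε (le_of_not_ge h)).le

theorem measureReal_le_integral_bump {ε : ℝ} (hε : 0 < ε) :
    μ.real {x : ℝ≥0 | (x : ℝ) ≤ ε} ≤ 8 * ∫ x : ℝ≥0, bump (2 * ε) x ∂μ := by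
  rw [← integral_indicator_one (measurableSet_coe_le ε), ← integral_const_mul]
  refine integral_mono ((integrable_const _).indicator (measurableSet_coe_le ε))
    (((isTest_bump (by positivity)).integrable μ).const_mul 8) fun x => ?_
  by_cases h : (x : ℝ) ≤ ε
  · rw [indicator_of_mem (show x ∈ {x : ℝ≥0 | (x : ℝ) ≤ ε} from h)]
    have h1 : (1 : ℝ) / 2 ≤ max (1 - (x : ℝ) / (2 * ε)) 0 := by
      refine le_max_of_le_left ?_
      have : (x : ℝ) / (2 * ε) ≤ 1 / 2 := by
        rw [div_le_div_iff₀ (by positivity) (by norm_num)]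
        linarith
      linarith
    have h2 : ((1 : ℝ) / 2) ^ 3 ≤ bump (2 * ε) x := by
      unfold bump
      gcongr
    simp only [Pi.one_apply]
    norm_num at h2
    linarith
  · rw [indicator_of_notMem (show x ∉ {x : ℝ≥0 | (x : ℝ) ≤ ε} from h)]
    exact mul_nonneg (by norm_num) (bump_nonneg _ _)

/-- With `y = x / δ` in `[0, 1]`, the square `(1 - y)²` in `N` is at most `2 (1 - y/2)³`; doubling
the scale passes from squares to the admissible cubes. -/
theorem mul_sqrt_le_integral_bump {n δ : ℝ} (hδ : 0 < δ) (h : ENNReal.ofReal n ≤ N (1 / 2) μ δ) :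
    n * √δ / 2 ≤ ∫ x : ℝ≥0, bump (2 * δ) x ∂μ := by
  have hint := ((isTest_bump (by positivity : 0 < 2 * δ)).integrable μ).const_mul 2
  have h1 : ∫⁻ x in {x : ℝ≥0 | (x : ℝ) ≤ δ}, ENNReal.ofReal ((1 - (x : ℝ) / δ) ^ 2) ∂μ ≤
      ENNReal.ofReal (∫ x : ℝ≥0, 2 * bump (2 * δ) x ∂μ) := by
    rw [ofReal_integral_eq_lintegral_ofReal hint
      (Eventually.of_forall fun x => mul_nonneg (by norm_num) (bump_nonneg _ _))]
    refine (setLIntegral_mono' (measurableSet_coe_le δ) fun x hx => ?_).trans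
      (setLIntegral_le_lintegral _ _)
    refine ENNReal.ofReal_le_ofReal ?_
    unfold bump
    have hy0 : 0 ≤ (x : ℝ) / δ := by positivity
    have hy1 : (x : ℝ) / δ ≤ 1 := (div_le_one hδ).2 hx
    rw [show (x : ℝ) / (2 * δ) = (x : ℝ) / δ / 2 by field_simp]
    generalize (x : ℝ) / δ = y at *
    rw [max_eq_left (by linarith)]
    nlinarith [mul_nonneg (sub_nonneg.2 hy1) (sq_nonneg (1 - y / 2)), mul_nonneg hy0 hy0]
  unfold N at h
  have h2 : ENNReal.ofReal n ≤
      ENNReal.ofReal (δ ^ (-(1 / 2 : ℝ)) * ∫ x : ℝ≥0, 2 * bump (2 * δ) x ∂μ) := by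
    rw [ENNReal.ofReal_mul (by positivity)]
    exact h.trans (by gcongr)
  have hpos : 0 ≤ ∫ x : ℝ≥0, bump (2 * δ) x ∂μ := integral_nonneg fun x => bump_nonneg _ _
  rw [integral_const_mul, ENNReal.ofReal_le_ofReal_iff (by positivity), Real.rpow_neg hδ.le,
    ← Real.sqrt_eq_rpow, inv_mul_eq_div, le_div_iff₀ (Real.sqrt_pos.2 hδ)] at h2
  linarith

theorem tendsto_integral_bump {ε : ℝ} (hε : 0 < ε) (h0 : μ {0} = 0) :
    Tendsto (fun k : ℕ => ∫ x : ℝ≥0, bump (ε / 4 ^ k) x ∂μ) atTop (𝓝 0) := by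
  have hz : ∫ _ : ℝ≥0, (0 : ℝ) ∂μ = 0 := by simp
  rw [← hz]
  refine tendsto_integral_of_dominated_convergence (fun _ => (1 : ℝ))
    (fun k => ((isTest_bump (by positivity)).integrable μ).aestronglyMeasurable)
    (integrable_const _) (fun k => Eventually.of_forall fun x => ?_) ?_
  · rw [Real.norm_eq_abs, abs_of_nonneg (bump_nonneg _ _)]
    exact bump_le_one (by positivity) x.2
  · have : ∀ᵐ x ∂μ, x ≠ 0 := measure_eq_zero_iff_ae_notMem.1 h0
    filter_upwards [this] with x hx
    have hx : 0 < (x : ℝ) := by positivity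
    have hlim : Tendsto (fun k : ℕ => ε / (4 : ℝ) ^ k) atTop (𝓝 0) :=
      (tendsto_pow_atTop_atTop_of_one_lt (by norm_num)).const_div_atTop ε
    refine tendsto_const_nhds.congr' ?_
    filter_upwards [hlim.eventually (Iio_mem_nhds hx)] with k hk
    exact (bump_eq_zero (by positivity) (le_of_lt hk)).symm

theorem collision_sum {f : ℕ → ℝ → ℝ} (hf : ∀ k, IsTest (f k)) (w : ℕ → ℝ) (s : Finset ℕ) :
    collision (fun x => ∑ k ∈ s, w k * f k x) μ = ∑ k ∈ s, w k * collision (f k) μ := by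
  unfold collision
  simp_rw [← integral_const_mul]
  rw [← integral_finsetSum _ fun k _ => ((hf k).integrable_collisionIntegrand _).const_mul _]
  refine integral_congr_ae (Eventually.of_forall fun p => ?_)
  simp only [collisionIntegrand]
  rw [← Finset.sum_add_distrib, ← Finset.sum_sub_distrib, ← Finset.sum_sub_distrib,
    Finset.mul_sum]
  exact Finset.sum_congr rfl fun k _ => by ring

/-- The mass in the shell `(ε 4^(-k-1), ε 4^(-k)]`. -/
def shellMass (ε : ℝ) (k : ℕ) : ℝ :=
  μ.real {x : ℝ≥0 | ε / 4 ^ k / 4 < (x : ℝ) ∧ (x : ℝ) ≤ ε / 4 ^ k}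

theorem measureReal_le_sum_shellMass (ε : ℝ) (K : ℕ) :
    μ.real {x : ℝ≥0 | (x : ℝ) ≤ ε} ≤
      ∑ k ∈ Finset.range K, shellMass μ ε k + μ.real {x : ℝ≥0 | (x : ℝ) ≤ ε / 4 ^ K} := by
  induction K with
  | zero => simp
  | succ K ih =>
    rw [Finset.sum_range_succ]
    have h : μ.real {x : ℝ≥0 | (x : ℝ) ≤ ε / 4 ^ K} ≤
        shellMass μ ε K + μ.real {x : ℝ≥0 | (x : ℝ) ≤ ε / 4 ^ (K + 1)} := by
      refine (measureReal_mono fun x hx => ?_).trans (measureReal_union_le _ _)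
      rcases lt_or_ge (ε / 4 ^ K / 4) (x : ℝ) with h | h
      · exact Or.inl ⟨h, hx⟩
      · refine Or.inr (h.trans (le_of_eq ?_))
        rw [pow_succ, div_div]
    linarith

end

/-! ### Elementary inequalities for sums and quadratic growth. -/

theorem sum_range_geometric (q : ℝ) (hq : q < 1) (hq0 : 0 ≤ q) (K : ℕ) :
    ∑ k ∈ Finset.range K, q ^ k ≤ 1 / (1 - q) := by
  rw [geom_sum_eq hq.ne, ← neg_div_neg_eq, neg_sub, neg_sub]
  have := pow_nonneg hq0 K
  gcongr
  linarith

/-- Cauchy-Schwarz with the weights `(3/4)^k`, whose sum is at most `4`, uniformly in `K`. -/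
theorem sq_sum_le_weighted (D : ℕ → ℝ) (K : ℕ) :
    (∑ k ∈ Finset.range K, D k) ^ 2 ≤ 4 * ∑ k ∈ Finset.range K, (4 / 3 : ℝ) ^ k * D k ^ 2 := by
  have h := Finset.sum_sq_le_sum_mul_sum_of_sq_le_mul (Finset.range K)
    (r := D) (f := fun k => (3 / 4 : ℝ) ^ k) (g := fun k => (4 / 3 : ℝ) ^ k * D k ^ 2)
    (fun k _ => by positivity) (fun k _ => by positivity) (fun k _ => by
      rw [← mul_assoc, ← mul_pow]; norm_num)
  refine h.trans ?_
  have h2 := sum_range_geometric (3 / 4) (by norm_num) (by norm_num) K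
  have h3 : 0 ≤ ∑ k ∈ Finset.range K, (4 / 3 : ℝ) ^ k * D k ^ 2 :=
    Finset.sum_nonneg fun k _ => by positivity
  norm_num at h2
  exact mul_le_mul_of_nonneg_right h2 h3

/-- A function with `F' ≥ A F²` and `F 0 > 0` cannot exist up to time `2 / (A F(0))`. -/
theorem lt_of_quadratic_growth {F : ℝ → ℝ} {A T : ℝ} (hA : 0 < A) (h0 : 0 < F 0)
    (h : ∀ s t, 0 ≤ s → s ≤ t → t ≤ T → (t - s) * (A * F s ^ 2) ≤ F t - F s) :
    T < 2 / (A * F 0) := by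
  by_contra! hT
  set a := 2 / (A * F 0) with ha
  have ha0 : 0 < a := by positivity
  have ht : ∀ n : ℕ, 0 ≤ a * (1 - (1 / 2) ^ n) ∧ a * (1 - (1 / 2) ^ n) ≤ T := fun n => by
    have h1 : (1 / 2 : ℝ) ^ n ≤ 1 := pow_le_one₀ (by norm_num) (by norm_num)
    have h2 : 0 < (1 / 2 : ℝ) ^ n := by positivity
    exact ⟨mul_nonneg ha0.le (by linarith), by nlinarith⟩
  -- `F` doubles on each of the successive intervals of lengths `a / 2`, `a / 4`, and so on, which
  -- all fit into `[0, T]`; no differentiability is needed.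
  have key : ∀ n : ℕ, 2 ^ n * F 0 ≤ F (a * (1 - (1 / 2) ^ n)) := by
    intro n
    induction n with
    | zero => simp
    | succ n ih =>
      have h2 : 0 < (1 / 2 : ℝ) ^ n := by positivity
      have h1 := h (a * (1 - (1 / 2) ^ n)) (a * (1 - (1 / 2) ^ (n + 1))) (ht n).1
        (by rw [pow_succ]; nlinarith) (ht (n + 1)).2
      have h3 : (2 ^ n * F 0) ^ 2 ≤ F (a * (1 - (1 / 2) ^ n)) ^ 2 := by gcongr
      have h4 : a * (1 - (1 / 2) ^ (n + 1)) - a * (1 - (1 / 2) ^ n) = 1 / (A * F 0 * 2 ^ n) := by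
        rw [ha, pow_succ, one_div_pow]
        field_simp
        ring
      rw [h4] at h1
      have h5 : 2 ^ n * F 0 ≤ 1 / (A * F 0 * 2 ^ n) * (A * F (a * (1 - (1 / 2) ^ n)) ^ 2) := by
        refine le_trans (le_of_eq ?_) (mul_le_mul_of_nonneg_left
          (mul_le_mul_of_nonneg_left h3 hA.le) (by positivity))
        field_simp
      rw [pow_succ]
      linarith
  obtain ⟨n, hn⟩ := pow_unbounded_of_one_lt (F T / F 0) (by norm_num : (1 : ℝ) < 2)
  rw [div_lt_iff₀ h0] at hn
  have h1 := h (a * (1 - (1 / 2) ^ n)) T (ht n).1 (ht n).2 le_rfl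
  have h2 : 0 ≤ (T - a * (1 - (1 / 2) ^ n)) * (A * F (a * (1 - (1 / 2) ^ n)) ^ 2) :=
    mul_nonneg (sub_nonneg.2 (ht n).2) (by positivity)
  linarith [key n]

/-! ### Multiscale growth of a solution without atom. -/

section

variable {ρ : ℝ} {g₀ : Measure ℝ≥0} {g : ℝ → Measure ℝ≥0}

theorem IsWeakSolution.integral_bump_mono (hsol : IsWeakSolution ρ g₀ g) (hρ : ρ < -1)
    (hc : ConservesMassEnergy g₀ g) {ε s t : ℝ} (hε : 0 < ε) (hs : 0 ≤ s) (hst : s ≤ t) :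
    ∫ x : ℝ≥0, bump ε x ∂(g s) ≤ ∫ x : ℝ≥0, bump ε x ∂(g t) := by
  have := hsol.mul_le_integral_sub hρ hc (isTest_bump hε) (A := 0) hs hst fun τ hτ => by
    have := hsol.isFiniteMeasure hρ (hs.trans hτ.1)
    exact collision_nonneg (g τ) (isTest_bump hε) (convexOn_bump ε)
  linarith

/-- A bounded convex weight which is strictly convex at every scale `ε 4^(-k)`, `k < K`. -/
def multiscaleBump (ε : ℝ) (K : ℕ) (x : ℝ) : ℝ :=
  ∑ k ∈ Finset.range K, (2 / 3 : ℝ) ^ k * bump (ε / 4 ^ k) x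

theorem isTest_multiscaleBump {ε : ℝ} (hε : 0 < ε) (K : ℕ) : IsTest (multiscaleBump ε K) :=
  IsTest.sum (fun k => (isTest_bump (by positivity)).const_mul _) _

theorem integral_multiscaleBump {ε : ℝ} (hε : 0 < ε) (K : ℕ) (μ : Measure ℝ≥0)
    [IsFiniteMeasure μ] :
    ∫ x : ℝ≥0, multiscaleBump ε K x ∂μ =
      ∑ k ∈ Finset.range K, (2 / 3 : ℝ) ^ k * ∫ x : ℝ≥0, bump (ε / 4 ^ k) x ∂μ := by
  unfold multiscaleBump
  rw [integral_finsetSum _ fun k _ =>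
    ((isTest_bump (by positivity)).integrable μ).const_mul _]
  simp_rw [integral_const_mul]

theorem integral_bump_le_multiscaleBump {ε : ℝ} (hε : 0 < ε) (K : ℕ) (μ : Measure ℝ≥0)
    [IsFiniteMeasure μ] :
    ∫ x : ℝ≥0, bump ε x ∂μ ≤ ∫ x : ℝ≥0, multiscaleBump ε (K + 1) x ∂μ := by
  rw [integral_multiscaleBump hε]
  have := Finset.single_le_sum (s := Finset.range (K + 1))
    (f := fun k : ℕ => (2 / 3 : ℝ) ^ k * ∫ x : ℝ≥0, bump (ε / 4 ^ k) x ∂μ)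
    (fun k _ => mul_nonneg (by positivity) (integral_nonneg fun x => bump_nonneg _ _))
    (Finset.mem_range.2 (Nat.succ_pos K))
  simpa using this

theorem integral_multiscaleBump_le {ε : ℝ} (hε : 0 < ε) (K : ℕ) (μ : Measure ℝ≥0)
    [IsFiniteMeasure μ] :
    ∫ x : ℝ≥0, multiscaleBump ε K x ∂μ ≤ 3 * ∫ x : ℝ≥0, bump ε x ∂μ := by
  rw [integral_multiscaleBump hε]
  have h0 : 0 ≤ ∫ x : ℝ≥0, bump ε x ∂μ := integral_nonneg fun x => bump_nonneg _ _
  have hq := sum_range_geometric (2 / 3) (by norm_num) (by norm_num) K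
  norm_num at hq
  calc _ ≤ ∑ k ∈ Finset.range K, (2 / 3 : ℝ) ^ k * ∫ x : ℝ≥0, bump ε x ∂μ := by
        refine Finset.sum_le_sum fun k _ => mul_le_mul_of_nonneg_left ?_ (by positivity)
        exact integral_mono ((isTest_bump (by positivity)).integrable μ)
          ((isTest_bump hε).integrable μ) fun x => bump_mono (by positivity)
            (div_le_self hε.le (one_le_pow₀ (by norm_num))) x.2
    _ ≤ _ := by
        rw [← Finset.sum_mul]
        exact mul_le_mul_of_nonneg_right hq h0

/-- If `μ` has mass at least of order `n √δ` near `0`, at all scales, then the collision integral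
against `multiscaleBump` controls the square of the mass. -/
theorem le_collision_multiscaleBump {ε n : ℝ} (hε : 0 < ε) (hn : 0 < n) (K : ℕ) (μ : Measure ℝ≥0)
    [IsFiniteMeasure μ]
    (hμ : ∀ k : ℕ, n * (√ε / 2 ^ k) / 8 ≤ μ.real {x : ℝ≥0 | (x : ℝ) ≤ ε / 4 ^ k / 8}) :
    n / (49152 * √ε) * (∑ k ∈ Finset.range K, shellMass μ ε k) ^ 2 ≤
      collision (multiscaleBump ε K) μ := by
  have hs : 0 < √ε := Real.sqrt_pos.2 hε
  have hss : √ε ^ 2 = ε := Real.sq_sqrt hε.le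
  have h1 : ∀ k : ℕ, n / (12288 * √ε) * (2 ^ k * shellMass μ ε k ^ 2) ≤
      collision (bump (ε / 4 ^ k)) μ := by
    intro k
    refine le_trans ?_ (le_collision_bump μ (ε := ε / 4 ^ k) (by positivity))
    have e : n / (12288 * √ε) * (2 ^ k * shellMass μ ε k ^ 2) =
        1 / (1536 * (ε / 4 ^ k)) * (n * (√ε / 2 ^ k) / 8) * shellMass μ ε k ^ 2 := by
      rw [← hss, show (4 : ℝ) ^ k = (2 ^ k) ^ 2 by rw [← pow_mul, mul_comm, pow_mul]; norm_num]
      rw [Real.sqrt_sq hs.le]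
      field_simp
      ring
    rw [e]
    refine mul_le_mul_of_nonneg_right (mul_le_mul_of_nonneg_left (hμ k) (by positivity))
      (sq_nonneg _)
  have h2 := sq_sum_le_weighted (shellMass μ ε) K
  have h3 : collision (multiscaleBump ε K) μ =
      ∑ k ∈ Finset.range K, (2 / 3 : ℝ) ^ k * collision (bump (ε / 4 ^ k)) μ :=
    collision_sum μ (fun k => isTest_bump (by positivity)) _ _
  rw [h3]
  calc _ ≤ n / (49152 * √ε) *
        (4 * ∑ k ∈ Finset.range K, (4 / 3 : ℝ) ^ k * shellMass μ ε k ^ 2) := by gcongr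
    _ = ∑ k ∈ Finset.range K,
        (2 / 3 : ℝ) ^ k * (n / (12288 * √ε) * (2 ^ k * shellMass μ ε k ^ 2)) := by
      rw [Finset.mul_sum, Finset.mul_sum]
      refine Finset.sum_congr rfl fun k _ => ?_
      -- The ratio `2/3` is below `1`, which keeps the weight bounded, and above `1/2`, so that the
      -- gain `2^k` still leaves a growing factor.
      rw [show (4 / 3 : ℝ) ^ k = (2 / 3) ^ k * 2 ^ k by rw [← mul_pow]; norm_num]
      field_simp
      ring
    _ ≤ _ := Finset.sum_le_sum fun k _ => mul_le_mul_of_nonneg_left (h1 k) (by positivity)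

theorem IsWeakSolution.lt_of_no_atom (hsol : IsWeakSolution ρ g₀ g) (hρ : ρ < -1)
    (hc : ConservesMassEnergy g₀ g) {ε n u T : ℝ} (hε : 0 < ε) (hn : 0 < n) (hu : 0 < u)
    (hT : 0 ≤ T) (hlow : ∀ δ, 0 < δ → δ ≤ ε → ENNReal.ofReal n ≤ N (1 / 2) g₀ δ)
    (hup : ENNReal.ofReal u ≤ N (1 / 2) g₀ (ε / 2)) (hatom : g T {0} = 0) :
    T < 14155776 / (n * u) := by
  have hfin : ∀ {t : ℝ}, 0 ≤ t → IsFiniteMeasure (g t) := fun ht => hsol.isFiniteMeasure hρ ht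
  have hs : 0 < √ε := Real.sqrt_pos.2 hε
  have := hfin le_rfl
  have := hfin hT
  have hm0 : u * √ε / 4 ≤ ∫ x : ℝ≥0, bump ε x ∂(g 0) := by
    rw [← hsol.initial] at hup
    have h := mul_sqrt_le_integral_bump (g 0) (by positivity) hup
    rw [mul_div_cancel₀ _ (two_ne_zero)] at h
    have h1 : √ε / 2 ≤ √(ε / 2) := by
      refine Real.le_sqrt_of_sq_le ?_
      rw [div_pow, Real.sq_sqrt hε.le]
      linarith
    nlinarith
  -- The factor `48 = 2 * 3 * 8` makes the innermost mass, multiplied by `3`, at most `F τ / 2`: the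
  -- `3` is the total weight, the `8` comes from `measureReal_le_integral_bump`. Monotonicity
  -- carries the bound from `T` back to all `τ ≤ T`.
  obtain ⟨K, hK⟩ : ∃ K : ℕ, 48 * ∫ x : ℝ≥0, bump (2 * (ε / 4 ^ (K + 1))) x ∂(g T) ≤
      u * √ε / 4 := by
    have h := ((tendsto_integral_bump (g T) (ε := 2 * ε) (by positivity) hatom).const_mul 48).comp
      (tendsto_add_atTop_nat 1)
    rw [mul_zero] at h
    obtain ⟨K, hK⟩ := (h.eventually (Iio_mem_nhds (show 0 < u * √ε / 4 by positivity))).exists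
    refine ⟨K, ?_⟩
    rw [← mul_div_assoc]
    exact le_of_lt hK
  set F : ℝ → ℝ := fun t => ∫ x : ℝ≥0, multiscaleBump ε (K + 1) x ∂(g t) with hF
  have hF0 : u * √ε / 4 ≤ F 0 := hm0.trans (integral_bump_le_multiscaleBump hε K (g 0))
  have hFpos : 0 < F 0 := lt_of_lt_of_le (by positivity) hF0
  have hFmono : ∀ s t, 0 ≤ s → s ≤ t → F s ≤ F t := by
    intro s t hs hst
    have := hfin hs
    have := hfin (hs.trans hst)
    simp only [hF]
    rw [integral_multiscaleBump hε, integral_multiscaleBump hε]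
    exact Finset.sum_le_sum fun k _ => mul_le_mul_of_nonneg_left
      (hsol.integral_bump_mono hρ hc (by positivity) hs hst) (by positivity)
  -- `1769472 = 36 * 49152`, since the shells carry at least `F τ / 6`.
  set A : ℝ := n / (1769472 * √ε) with hA
  have hApos : 0 < A := by positivity
  have hcoll : ∀ τ, 0 ≤ τ → τ ≤ T → A * F τ ^ 2 ≤ collision (multiscaleBump ε (K + 1)) (g τ) := by
    intro τ hτ hτT
    have := hfin hτ
    refine le_trans ?_ (le_collision_multiscaleBump hε hn (K + 1) (g τ) fun k => ?_)
    · have h1 := integral_multiscaleBump_le hε (K + 1) (g τ)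
      have h2 := integral_bump_le_measureReal (g τ) hε
      have h3 := measureReal_le_sum_shellMass (g τ) ε (K + 1)
      have h4 := measureReal_le_integral_bump (g τ) (ε := ε / 4 ^ (K + 1)) (by positivity)
      have h5 := hsol.integral_bump_mono hρ hc (ε := 2 * (ε / 4 ^ (K + 1))) (by positivity) hτ hτT
      have h6 : F 0 ≤ F τ := hFmono 0 τ le_rfl hτ
      have h7 : F τ / 6 ≤ ∑ k ∈ Finset.range (K + 1), shellMass (g τ) ε k := by
        change F τ ≤ _ at h1
        linarith
      have h8 : 0 ≤ F τ / 6 := by linarith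
      calc A * F τ ^ 2 = n / (49152 * √ε) * (F τ / 6) ^ 2 := by
            rw [hA]; field_simp; ring
        _ ≤ _ := by gcongr
    · have h4k : (1 : ℝ) ≤ 4 ^ k := one_le_pow₀ (by norm_num)
      -- Half of the radius `ε / 4 ^ k / 8`, because passing from `N` to `bump` doubles the scale.
      have h1 := hlow (ε / 4 ^ k / 16) (by positivity) (by
        rw [div_div]
        exact div_le_self hε.le (by linarith))
      rw [← hsol.initial] at h1
      have h2 := mul_sqrt_le_integral_bump (g 0) (by positivity) h1
      rw [show 2 * (ε / 4 ^ k / 16) = ε / 4 ^ k / 8 by ring] at h2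
      have h3 : √(ε / 4 ^ k / 16) = √ε / 2 ^ k / 4 := by
        rw [Real.sqrt_div (by positivity), Real.sqrt_div hε.le,
          show (4 : ℝ) ^ k = (2 ^ k) ^ 2 by rw [← pow_mul, mul_comm, pow_mul]; norm_num,
          Real.sqrt_sq (by positivity), show (16 : ℝ) = 4 ^ 2 by norm_num,
          Real.sqrt_sq (by norm_num)]
      rw [h3] at h2
      have h5 := hsol.integral_bump_mono hρ hc (ε := ε / 4 ^ k / 8) (by positivity) le_rfl hτ
      have h6 := integral_bump_le_measureReal (g τ) (ε := ε / 4 ^ k / 8) (by positivity)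
      linarith
  have hlt := lt_of_quadratic_growth (F := F) (A := A) (T := T) hApos hFpos fun s t hs hst htT => by
    refine hsol.mul_le_integral_sub hρ hc (isTest_multiscaleBump hε (K + 1)) hs hst
      fun τ hτ => ?_
    refine le_trans ?_ (hcoll τ (hs.trans hτ.1) (hτ.2.trans htT))
    have h1 := hFmono 0 s le_rfl hs
    have h2 := hFmono s τ hs hτ.1
    gcongr
    linarith
  refine hlt.trans_le ?_
  calc 2 / (A * F 0) ≤ 2 / (A * (u * √ε / 4)) := by gcongr
    _ = 14155776 / (n * u) := by rw [hA]; field_simp; norm_num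

/-- Approximating both factors by finite `n` and `u` from below also covers infinite limits. The
lower bound holds at all scales up to some `ε₀`, while `u` needs only one scale `δ`, taken at most
`ε₀ / 2` so that `ε = 2 * δ` is admissible. -/
theorem IsWeakSolution.lowerN_mul_upperN_le (hsol : IsWeakSolution ρ g₀ g) (hρ : ρ < -1)
    (hc : ConservesMassEnergy g₀ g) {T : ℝ} (hT : 0 < T) (hatom : g T {0} = 0) :
    lowerN (1 / 2) g₀ * upperN (1 / 2) g₀ ≤ ENNReal.ofReal (14155776 / T) := by
  refine ENNReal.mul_le_of_forall_lt fun n hn u hu => ?_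
  lift n to ℝ≥0 using hn.ne_top
  lift u to ℝ≥0 using hu.ne_top
  rcases eq_or_ne n 0 with rfl | hn0
  · simp
  rcases eq_or_ne u 0 with rfl | hu0
  · simp
  have hn' : 0 < (n : ℝ) := by positivity
  have hu' : 0 < (u : ℝ) := by positivity
  unfold lowerN at hn
  simp only [lt_iSup_iff] at hn
  obtain ⟨ε₀, hε₀, hlow⟩ := hn
  have hε₀ : 0 < ε₀ := hε₀
  have hu1 : (u : ℝ≥0∞) < upperNAt (1 / 2) g₀ (ε₀ / 2) :=
    hu.trans_le (iInf₂_le (ε₀ / 2) (show (0 : ℝ) < ε₀ / 2 by positivity))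
  simp only [upperNAt, lt_iSup_iff] at hu1
  obtain ⟨δ, hδ, hup⟩ := hu1
  have key := hsol.lt_of_no_atom hρ hc (ε := 2 * δ) (n := n) (u := u) (by linarith [hδ.1]) hn' hu'
    hT.le (fun δ' h1 h2 => by
      rw [ENNReal.ofReal_coe_nnreal]
      exact hlow.le.trans (iInf₂_le δ' ⟨h1, by linarith [hδ.2]⟩))
    (by
      rw [ENNReal.ofReal_coe_nnreal, mul_div_cancel_left₀ _ (two_ne_zero)]
      exact hup.le) hatom
  rw [← ENNReal.ofReal_coe_nnreal, ← ENNReal.ofReal_coe_nnreal (p := u),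
    ← ENNReal.ofReal_mul n.coe_nonneg]
  refine ENNReal.ofReal_le_ofReal ?_
  rw [lt_div_iff₀ (by positivity)] at key
  rw [le_div_iff₀ hT]
  linarith

end

end

end WaveKinetic

theorem mainTheorem3 :
    ∃ C : ℝ, 0 < C ∧
      ∀ (ρ : ℝ) (g₀ : MeasureTheory.Measure NNReal) (g : ℝ → MeasureTheory.Measure NNReal),
        ρ < -1 →
        WaveKinetic.rhoNorm ρ g₀ < ⊤ →
        WaveKinetic.IsWeakSolution ρ g₀ g →
        WaveKinetic.ConservesMassEnergy g₀ g →
        ∀ t : ℝ,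
          ENNReal.ofReal C *
              (WaveKinetic.lowerN (1 / 2) g₀ * WaveKinetic.upperN (1 / 2) g₀)⁻¹ <
            ENNReal.ofReal t →
          0 < g t {0} := by
  -- `14155776 = 2 * 4 * 1769472`, from `2 / (A * F 0)` with `F 0 ≥ u * √ε / 4`. The conventions
  -- `0⁻¹ = ∞`, `∞⁻¹ = 0` and `0 * ∞ = 0` in `ℝ≥0∞` give the degenerate values of the threshold.
  refine ⟨14155776, by norm_num, fun ρ g₀ g hρ _ hsol hc t ht => ?_⟩
  have ht0 : 0 < t := ENNReal.ofReal_pos.1 (lt_of_le_of_lt zero_le ht)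
  by_contra hatom
  have h := hsol.lowerN_mul_upperN_le hρ hc ht0 (nonpos_iff_eq_zero.1 (not_lt.1 hatom))
  refine absurd ht (not_lt.2 ?_)
  calc ENNReal.ofReal t
      = ENNReal.ofReal 14155776 * (ENNReal.ofReal (14155776 / t))⁻¹ := by
        rw [← ENNReal.ofReal_inv_of_pos (by positivity), ← ENNReal.ofReal_mul (by norm_num)]
        congr 1
        field_simp
    _ ≤ _ := by gcongr
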